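/- **Setting.** Let $\mathbb K$ be a field of characteristic zero, $\ell:\mathbb N\setminus\{0\}\to\mathbb K^\times$ a monoid homomorphism (for the multiplication of positive integers) and $\mathcal K$ a set of finite groups. Write $\ell(A)=\ell(|A|)$ for a finite group $A$. Let $\Lambda=\Lambda_{\mathcal K}$ be the (not necessarily unital) $\mathbb K$-algebra with basis the elements $s_U^{F,G}$ for $F,G\in\mathcal K$, $U\le F\times G$, and multiplication $$s_U^{F,G}\,s_V^{G,H}=\ell\big(\{g: (1,g)\in U,\ (g,1)\in V\}\big)\,s_{U*V}^{F,H},\qquad U*V=\{(f,h):\exists g\in G,\ (f,g)\in U,\ (g,h)\in V\},$$ and $s_U^{F,G}s_V^{G',H}=0$ if $G\ne G'$. For $G\in\mathcal K$ put $\mathrm{id}_G=s^{G,G}_{\{(g,g)\,:\,g\in G\}}$. A $\Lambda$-module is an abelian group with a biadditive associative action of $\Lambda$ such that every element is fixed by an idempotent of $\Lambda$; $M(G)=\mathrm{id}_GM$; $M$ is simple if $M\neq0$ and its only submodules are $0$ and $M$. For $E\in\mathcal K$ let $\mu_E:\mathbb K\mathrm{Aut}(E)\to\Lambda$ be the linear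 map $\theta\mapsto s^{E,E}_{\{(\theta(x),x)\,:\,x\in E\}}$. For finite groups write $[E]\le[G]$, and call $E$ a factor group of $G$, if $E\cong B/Y$ for some $Y\unlhd B\le G$; this is a partial order on isomorphism classes. An $\mathcal S$-seed for $\mathcal K$ is a pair $(E,W)$ with $E$ a factor group of an element of $\mathcal K$ and $W$ a simple $\mathbb K\mathrm{Aut}(E)$-module; $(E,W)$ and $(E',W')$ are equivalent if, for some group isomorphism $\theta:E'\to E$, $W$ is isomorphic to the transport of $W'$ along the isomorphism $\mathbb K\mathrm{Aut}(E')\to\mathbb K\mathrm{Aut}(E)$ induced by $\theta$. **The module $S_{E,W}$.** Let $\mathcal K'\supseteq\mathcal K$ be a set of finite groups containing an isomorphic copy of every subquotient of each of its elements. A simple $\Lambda_{\mathcal K'}$-module $S'$ is said to correspond to the seed $(E,W)$ if, for some equivalent seed $(E_1,W_1)$ with $E_1\in\mathcal K'$, the class $[E_1]$ is minimal among the classes $[F]$ with $F\in\mathcal K'$, $S'(F)\ne0$, and $W_1\cong S'(E_1)$, where $\mathbb K\mathrm{Aut}(E_1)$ acts via $\mu_{E_1}$. Then $S_{E,W}=\Lambda_{\mathcal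 K}S'$, the subgroup of $S'$ generated by all $as$ with $a\in\Lambda_{\mathcal K}\subseteq\Lambda_{\mathcal K'}$, $s\in S'$, regarded as a $\Lambda_{\mathcal K}$-module. **Theorem.** For all $\mathcal K$, $\mathbb K$, $\ell$ as above: 1. For every seed $(E,W)$ for $\mathcal K$ and every $\mathcal K'$ as above, a simple $\Lambda_{\mathcal K'}$-module $S'$ corresponding to $(E,W)$ exists; for any such $S'$, the $\Lambda$-module $\Lambda_{\mathcal K}S'$ is simple; and its isomorphism class does not depend on the choices of $\mathcal K'$ and $S'$. So $S_{E,W}$ is a simple $\Lambda$-module that is well defined up to isomorphism. 2. The condition $S\cong S_{E,W}$ characterizes a bijective correspondence $[S]\leftrightarrow[E,W]$ between the isomorphism classes $[S]$ of simple $\Lambda$-modules and the equivalence classes $[E,W]$ of $\mathcal S$-seeds for $\mathcal K$. 3. For a simple $\Lambda$-module $S$ and a seed $(E,W)$ for $\mathcal K$, we have $S\cong S_{E,W}$ if and only if the following three conditions hold: (a) for every $G\in\mathcal K$: $S(G)\ne0$ if and only if $[E]\le[G]$; (b) for all $G\in\mathcal K$, $Y\unlhd B\le G$, every isomorphism $\phi:B/Y\to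 E$ and every idempotent $k$ of $\mathbb K\mathrm{Aut}(E)$: $\mu_\phi(k)S(G)\neq0$ if and only if $kW\ne0$, where $\mu_\phi:\mathbb K\mathrm{Aut}(E)\to\Lambda$ is the linear map with $$\mu_\phi(\epsilon)=\ell(Y)^{-1}s^{G,G}_{\Delta_\epsilon},\qquad \Delta_\epsilon=\{(a,b)\in B\times B:\ aY=\phi^{-1}\epsilon\phi(bY)\}\qquad(\epsilon\in\mathrm{Aut}(E));$$ (c) $[E]\le[E']$ for every seed $(E',W')$ for $\mathcal K$ satisfying (a) and (b) (with $(E',W')$ in place of $(E,W)$). -/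

import Mathlib

universe u k

noncomputable section

open scoped Classical

namespace SubgroupCat

/-! ### Subgroups of direct products -/

section Groups

variable {R S T : Type*} [Group R] [Group S] [Group T]

/-- The star product `U * V` of `U ≤ R × S` and `V ≤ S × T`. -/
def star (U : Subgroup (R × S)) (V : Subgroup (S × T)) : Subgroup (R × T) where
  carrier := {p | ∃ s : S, (p.1, s) ∈ U ∧ (s, p.2) ∈ V}
  one_mem' := ⟨1, U.one_mem, V.one_mem⟩
  mul_mem' := by
    rintro p q ⟨s, h1, h2⟩ ⟨t, h3, h4⟩
    exact ⟨s * t, U.mul_mem h1 h3, V.mul_mem h2 h4⟩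
  inv_mem' := by
    rintro p ⟨s, h1, h2⟩
    exact ⟨s⁻¹, U.inv_mem h1, V.inv_mem h2⟩

/-- For `U ≤ R × S`, the subgroup `{s | (1, s) ∈ U}` of `S`. -/
def rightKer (U : Subgroup (R × S)) : Subgroup S := U.comap (MonoidHom.inr R S)

/-- For `V ≤ S × T`, the subgroup `{s | (s, 1) ∈ V}` of `S`. -/
def leftKer (V : Subgroup (S × T)) : Subgroup S := V.comap (MonoidHom.inl S T)

/-- The subgroup `Δ(A, X, θ, Y, B) = {(a, b) ∈ A × B | aX = θ(bY)}` of `R × S`, where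
`X ⊴ A ≤ R`, `Y ⊴ B ≤ S` and `θ` is an isomorphism to `A / X` from `B / Y`. -/
def goursat (A : Subgroup R) (X : Subgroup A) [X.Normal] (B : Subgroup S) (Y : Subgroup B)
    [Y.Normal] (θ : B ⧸ Y ≃* A ⧸ X) : Subgroup (R × S) :=
  (((QuotientGroup.mk' X).comp (MonoidHom.fst A B)).eqLocus
    ((θ.toMonoidHom.comp (QuotientGroup.mk' Y)).comp (MonoidHom.snd A B))).map
      (A.subtype.prodMap B.subtype)

/-- The subgroup `Δ(θ) = {(θ s, s) | s ∈ S}` of `R × S`, for an isomorphism `θ` to `R`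
from `S`. -/
def graph (θ : S ≃* R) : Subgroup (R × S) := (θ.toMonoidHom.prod (MonoidHom.id S)).range

/-- `E` is a factor group of `G`, written `[E] ≤ [G]`: it is isomorphic to a subquotient of `G`. -/
def IsFactorGroup (E G : Type*) [Group E] [Group G] : Prop :=
  ∃ (B : Subgroup G) (Y : Subgroup B) (_ : Y.Normal), Nonempty (B ⧸ Y ≃* E)

theorem mem_star {U : Subgroup (R × S)} {V : Subgroup (S × T)} {r : R} {t : T} :
    (r, t) ∈ star U V ↔ ∃ s, (r, s) ∈ U ∧ (s, t) ∈ V := Iff.rfl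

theorem mem_graph {θ : S ≃* R} {r : R} {s : S} : (r, s) ∈ graph θ ↔ r = θ s := by
  simp [graph, MonoidHom.mem_range, eq_comm]

theorem mem_rightKer {U : Subgroup (R × S)} {s : S} : s ∈ rightKer U ↔ (1, s) ∈ U := Iff.rfl

theorem mem_leftKer {V : Subgroup (S × T)} {s : S} : s ∈ leftKer V ↔ (s, 1) ∈ V := Iff.rfl

theorem star_assoc {Q : Type*} [Group Q] (U : Subgroup (R × S)) (V : Subgroup (S × T))
    (W : Subgroup (T × Q)) : star (star U V) W = star U (star V W) := by
  ext ⟨r, q⟩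
  simp only [mem_star]
  constructor
  · rintro ⟨t, ⟨s, h1, h2⟩, h3⟩
    exact ⟨s, h1, t, h2, h3⟩
  · rintro ⟨s, h1, t, h2, h3⟩
    exact ⟨t, ⟨s, h1, h2⟩, h3⟩

theorem graph_refl_star (U : Subgroup (R × S)) : star (graph (MulEquiv.refl R)) U = U := by
  ext ⟨r, s⟩
  simp [mem_star, mem_graph]

theorem card_eq_fst (A : Subgroup (R × S)) :
    Nat.card A = Nat.card (A.map (MonoidHom.fst R S)) * Nat.card (rightKer A) := by
  have h := Subgroup.card_mul_index ((MonoidHom.fst R S).comp A.subtype).ker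
  rw [Subgroup.index_ker, MonoidHom.range_comp, Subgroup.range_subtype] at h
  rw [← h, mul_comm]
  congr 1
  refine Nat.card_congr
    { toFun := fun x => ⟨x.1.1.2, ?_⟩
      invFun := fun s => ⟨⟨(1, s.1), s.2⟩, rfl⟩
      left_inv := ?_
      right_inv := ?_ }
  · rcases x with ⟨⟨⟨r, s⟩, hx⟩, hk⟩
    have hr : r = 1 := hk
    subst hr
    exact hx
  · rintro ⟨⟨⟨r, s⟩, hx⟩, hk⟩
    have hr : r = 1 := hk
    subst hr
    rfl
  · intro s
    rfl

theorem card_eq_snd (A : Subgroup (R × S)) :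
    Nat.card A = Nat.card (leftKer A) * Nat.card (A.map (MonoidHom.snd R S)) := by
  have h := Subgroup.card_mul_index ((MonoidHom.snd R S).comp A.subtype).ker
  rw [Subgroup.index_ker, MonoidHom.range_comp, Subgroup.range_subtype] at h
  rw [← h]
  congr 1
  refine Nat.card_congr
    { toFun := fun x => ⟨x.1.1.1, ?_⟩
      invFun := fun r => ⟨⟨(r.1, 1), r.2⟩, rfl⟩
      left_inv := ?_
      right_inv := ?_ }
  · rcases x with ⟨⟨⟨r, s⟩, hx⟩, hk⟩
    have hr : s = 1 := hk
    subst hr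
    exact hx
  · rintro ⟨⟨⟨r, s⟩, hx⟩, hk⟩
    have hr : s = 1 := hk
    subst hr
    rfl
  · intro s
    rfl

theorem card_cocycle {Q : Type*} [Group Q] (U : Subgroup (R × S)) (V : Subgroup (S × T))
    (W : Subgroup (T × Q)) :
    Nat.card ↥(rightKer U ⊓ leftKer V) * Nat.card ↥(rightKer (star U V) ⊓ leftKer W) =
      Nat.card ↥(rightKer U ⊓ leftKer (star V W)) * Nat.card ↥(rightKer V ⊓ leftKer W) := by
  let A : Subgroup (S × T) := V ⊓ (rightKer U).prod (leftKer W)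
  have hA : ∀ s t, (s, t) ∈ A ↔ (s, t) ∈ V ∧ (1, s) ∈ U ∧ (t, 1) ∈ W := fun s t => Iff.rfl
  have e1 : rightKer U ⊓ leftKer V = leftKer A := by
    ext s
    simp only [Subgroup.mem_inf, mem_rightKer, mem_leftKer, hA]
    exact ⟨fun h => ⟨h.2, h.1, W.one_mem⟩, fun h => ⟨h.2.1, h.1⟩⟩
  have e2 : rightKer V ⊓ leftKer W = rightKer A := by
    ext t
    simp only [Subgroup.mem_inf, mem_rightKer, mem_leftKer, hA]
    exact ⟨fun h => ⟨h.1, U.one_mem, h.2⟩, fun h => ⟨h.1, h.2.2⟩⟩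
  have e3 : rightKer (star U V) ⊓ leftKer W = A.map (MonoidHom.snd S T) := by
    ext t
    simp only [Subgroup.mem_inf, mem_rightKer, mem_leftKer, mem_star, Subgroup.mem_map, Prod.exists,
      hA]
    constructor
    · rintro ⟨⟨s, h1, h2⟩, h3⟩
      exact ⟨s, t, ⟨h2, h1, h3⟩, rfl⟩
    · rintro ⟨s, t', ⟨h2, h1, h3⟩, rfl⟩
      exact ⟨⟨s, h1, h2⟩, h3⟩
  have e4 : rightKer U ⊓ leftKer (star V W) = A.map (MonoidHom.fst S T) := by
    ext s
    simp only [Subgroup.mem_inf, mem_rightKer, mem_leftKer, mem_star, Subgroup.mem_map, Prod.exists,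
      hA]
    constructor
    · rintro ⟨h1, t, h2, h3⟩
      exact ⟨s, t, ⟨h2, h1, h3⟩, rfl⟩
    · rintro ⟨s', t, ⟨h2, h1, h3⟩, rfl⟩
      exact ⟨h1, t, h2, h3⟩
  rw [e1, e2, e3, e4, ← card_eq_snd, ← card_eq_fst]

end Groups

/-- The set `K` of finite groups is closed under factor groups up to isomorphism: it owns an
isomorphic copy of every subquotient of every element. -/
def ClosedUnderFactorGroups (K : Set FiniteGrp.{u}) : Prop :=
  ∀ G ∈ K, ∀ (B : Subgroup G) (Y : Subgroup B) [Y.Normal], ∃ E ∈ K, Nonempty (B ⧸ Y ≃* E)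

/-! ### The twisted category algebra -/

section Cocycle

variable {𝕂 : Type k} [Field 𝕂]

/-- `ℓ(|A|)` for a finite group `A`, as an element of the field. -/
def ell (ℓ : ℕ+ →* 𝕂ˣ) (A : Type*) [Group A] [Finite A] : 𝕂 :=
  (ℓ (Nat.toPNat (Nat.card A) Nat.card_pos) : 𝕂ˣ)

/-- The cocycle `σ(U, V) = ℓ({g | (1, g) ∈ U} ∩ {g | (g, 1) ∈ V})`. -/
def sigma (ℓ : ℕ+ →* 𝕂ˣ) {F G H : Type*} [Group F] [Group G] [Group H] [Finite G]
    (U : Subgroup (F × G)) (V : Subgroup (G × H)) : 𝕂 :=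
  ell ℓ ↥(rightKer U ⊓ leftKer V)

theorem ell_ne_zero (ℓ : ℕ+ →* 𝕂ˣ) (A : Type*) [Group A] [Finite A] : ell ℓ A ≠ 0 :=
  Units.ne_zero _

theorem ell_mul_ell (ℓ : ℕ+ →* 𝕂ˣ) {A B C D : Type*} [Group A] [Finite A] [Group B] [Finite B]
    [Group C] [Finite C] [Group D] [Finite D]
    (h : Nat.card A * Nat.card B = Nat.card C * Nat.card D) :
    ell ℓ A * ell ℓ B = ell ℓ C * ell ℓ D := by
  unfold ell
  rw [← Units.val_mul, ← Units.val_mul, ← map_mul, ← map_mul]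
  exact congrArg (fun n => ((ℓ n : 𝕂ˣ) : 𝕂)) (PNat.eq h)

theorem sigma_cocycle (ℓ : ℕ+ →* 𝕂ˣ) {F G H I : Type*} [Group F] [Group G] [Group H] [Group I]
    [Finite G] [Finite H] (U : Subgroup (F × G)) (V : Subgroup (G × H)) (W : Subgroup (H × I)) :
    sigma ℓ U V * sigma ℓ (star U V) W = sigma ℓ U (star V W) * sigma ℓ V W :=
  ell_mul_ell ℓ (card_cocycle U V W)

theorem sigma_graph_refl (ℓ : ℕ+ →* 𝕂ˣ) {F G : Type*} [Group F] [Group G] [Finite F]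
    (U : Subgroup (F × G)) : sigma ℓ (graph (MulEquiv.refl F)) U = 1 := by
  have h : rightKer (graph (MulEquiv.refl F)) ⊓ leftKer U = ⊥ := by
    rw [eq_bot_iff]
    rintro x ⟨hx, -⟩
    exact (mem_graph.1 hx).symm
  have h1 : Nat.toPNat (Nat.card ↥(rightKer (graph (MulEquiv.refl F)) ⊓ leftKer U)) Nat.card_pos
      = 1 := PNat.eq ((congrArg (fun A : Subgroup F => Nat.card A) h).trans Subgroup.card_bot)
  unfold sigma ell
  rw [h1, map_one, Units.val_one]

end Cocycle

/-- The morphisms of the full subcategory on `K` of the subgroup category: the morphisms to `F`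
from `G` are the subgroups of `F × G`. -/
structure Mor (K : Set FiniteGrp.{u}) where
  cod : K
  dom : K
  sub : Subgroup (cod.1 × dom.1)

/-- The algebra `Λ` over `𝕂` determined by `K`, `𝕂`, `ℓ`: its underlying vector space has a basis
indexed by the morphisms of the subgroup category on `K`. -/
def Lam {𝕂 : Type k} [Field 𝕂] (_ℓ : ℕ+ →* 𝕂ˣ) (K : Set FiniteGrp.{u}) : Type (max k (u + 1)) :=
  Mor K →₀ 𝕂

namespace Lam

variable {𝕂 : Type k} [Field 𝕂] {ℓ : ℕ+ →* 𝕂ˣ} {K K' : Set FiniteGrp.{u}}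

instance : AddCommGroup (Lam ℓ K) := inferInstanceAs (AddCommGroup (Mor K →₀ 𝕂))

instance : Module 𝕂 (Lam ℓ K) := inferInstanceAs (Module 𝕂 (Mor K →₀ 𝕂))

/-- The square basis. -/
def basis (ℓ : ℕ+ →* 𝕂ˣ) (K : Set FiniteGrp.{u}) : Module.Basis (Mor K) 𝕂 (Lam ℓ K) :=
  Module.Basis.ofRepr (LinearEquiv.refl 𝕂 (Mor K →₀ 𝕂))

/-- The element `s_U` of the square basis, for `U ≤ F × G`. -/
def s (ℓ : ℕ+ →* 𝕂ˣ) {F G : K} (U : Subgroup (F.1 × G.1)) : Lam ℓ K := basis ℓ K ⟨F, G, U⟩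

/-- The product of two basis elements: `s_U s_V = σ(U, V) s_{U * V}` if the domain of `U` is the
codomain of `V`, and zero otherwise. -/
def basisMul (ℓ : ℕ+ →* 𝕂ˣ) : Mor K → Mor K → Lam ℓ K
  | ⟨_, G, U⟩, ⟨G', _, V⟩ =>
    if h : G' = G then by
      subst h
      exact sigma ℓ U V • s ℓ (star U V)
    else 0

/-- The multiplication of `Λ`, as the bilinear extension of the product of basis elements. -/
def mulLin (ℓ : ℕ+ →* 𝕂ˣ) (K : Set FiniteGrp.{u}) : Lam ℓ K →ₗ[𝕂] Lam ℓ K →ₗ[𝕂] Lam ℓ K :=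
  (basis ℓ K).constr 𝕂 fun U => (basis ℓ K).constr 𝕂 fun V => basisMul ℓ U V

instance : Mul (Lam ℓ K) := ⟨fun a b => mulLin ℓ K a b⟩

theorem mul_def (a b : Lam ℓ K) : a * b = mulLin ℓ K a b := rfl

theorem s_mul_s {F G H : K} (U : Subgroup (F.1 × G.1)) (V : Subgroup (G.1 × H.1)) :
    s ℓ U * s ℓ V = sigma ℓ U V • s ℓ (star U V) := by
  simp [mul_def, mulLin, s, basisMul]

theorem s_mul_s_of_ne {F G G' H : K} (h : G' ≠ G) (U : Subgroup (F.1 × G.1))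
    (V : Subgroup (G'.1 × H.1)) : s ℓ U * s ℓ V = 0 := by
  simp [mul_def, mulLin, s, basisMul, h]

theorem smul_mul (c : 𝕂) (a b : Lam ℓ K) : (c • a) * b = c • (a * b) := by
  simp [mul_def]

theorem mul_smul' (c : 𝕂) (a b : Lam ℓ K) : a * (c • b) = c • (a * b) := by
  simp [mul_def]

theorem mul_assoc_s {F G G' H H' I : K} (U : Subgroup (F.1 × G.1)) (V : Subgroup (G'.1 × H.1))
    (W : Subgroup (H'.1 × I.1)) : s ℓ U * s ℓ V * s ℓ W = s ℓ U * (s ℓ V * s ℓ W) := by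
  have z1 : ∀ a : Lam ℓ K, 0 * a = 0 := fun a => by simp [mul_def]
  have z2 : ∀ a : Lam ℓ K, a * 0 = 0 := fun a => by simp [mul_def]
  by_cases h : G' = G
  · subst h
    by_cases h' : H' = H
    · subst h'
      rw [s_mul_s, s_mul_s, smul_mul, mul_smul', s_mul_s, s_mul_s, smul_smul, smul_smul,
        sigma_cocycle, star_assoc, mul_comm (sigma ℓ V W)]
    · rw [s_mul_s, smul_mul, s_mul_s_of_ne h', s_mul_s_of_ne h', z2, smul_zero]
  · by_cases h' : H' = H
    · subst h'
      rw [s_mul_s_of_ne h, z1, s_mul_s, mul_smul', s_mul_s_of_ne h, smul_zero]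
    · rw [s_mul_s_of_ne h, z1, s_mul_s_of_ne h', z2]

theorem induction_s {P : Lam ℓ K → Prop} (a : Lam ℓ K) (h0 : P 0)
    (hadd : ∀ a b, P a → P b → P (a + b))
    (hs : ∀ (c : 𝕂) (F G : K) (U : Subgroup (F.1 × G.1)), P (c • s ℓ U)) : P a := by
  rw [← (basis ℓ K).linearCombination_repr a, Finsupp.linearCombination_apply, Finsupp.sum]
  exact Finset.sum_induction _ P hadd h0 fun U _ => hs _ U.cod U.dom U.sub

instance : NonUnitalRing (Lam ℓ K) where
  zero_mul a := by simp [mul_def]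
  mul_zero a := by simp [mul_def]
  left_distrib a b c := by simp [mul_def]
  right_distrib a b c := by simp [mul_def]
  mul_assoc a b c := by
    have ha : ∀ x y z : Lam ℓ K, (x + y) * z = x * z + y * z := fun x y z => by simp [mul_def]
    have hb : ∀ x y z : Lam ℓ K, x * (y + z) = x * y + x * z := fun x y z => by simp [mul_def]
    have z1 : ∀ a : Lam ℓ K, 0 * a = 0 := fun a => by simp [mul_def]
    have z2 : ∀ a : Lam ℓ K, a * 0 = 0 := fun a => by simp [mul_def]
    induction a using induction_s with
    | h0 => simp only [z1]
    | hadd x y hx hy => simp only [ha, hx, hy]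
    | hs c1 F G U =>
      induction b using induction_s with
      | h0 => simp only [z1, z2]
      | hadd x y hx hy => simp only [ha, hb, hx, hy]
      | hs c2 G' H V =>
        induction c using induction_s with
        | h0 => simp only [z2]
        | hadd x y hx hy => simp only [hb, hx, hy]
        | hs c3 H' I W => simp only [smul_mul, mul_smul', mul_assoc_s]

instance : IsScalarTower 𝕂 (Lam ℓ K) (Lam ℓ K) := ⟨fun c a b => smul_mul c a b⟩

instance : SMulCommClass 𝕂 (Lam ℓ K) (Lam ℓ K) := ⟨fun c a b => (mul_smul' c a b).symm⟩

/-- The identity morphism `id_G = s_{Δ(G)}` on `G`. -/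
def idm (ℓ : ℕ+ →* 𝕂ˣ) (G : K) : Lam ℓ K := s ℓ (graph (MulEquiv.refl G.1))

theorem idm_mul_s {F G : K} (U : Subgroup (F.1 × G.1)) : idm ℓ F * s ℓ U = s ℓ U := by
  rw [idm, s_mul_s, sigma_graph_refl, one_smul, graph_refl_star]

theorem idm_mul_s_of_ne {F F' G : K} (h : F ≠ F') (U : Subgroup (F.1 × G.1)) :
    idm ℓ F' * s ℓ U = 0 := s_mul_s_of_ne h _ _

/-- The sum of the identity morphisms on the objects in a finite set. -/
def idSum (ℓ : ℕ+ →* 𝕂ˣ) (T : Finset K) : Lam ℓ K := ∑ G ∈ T, idm ℓ G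

theorem idSum_mul_s {T : Finset K} {F G : K} (hF : F ∈ T) (U : Subgroup (F.1 × G.1)) :
    idSum ℓ T * s ℓ U = s ℓ U := by
  rw [idSum, Finset.sum_mul, Finset.sum_eq_single F, idm_mul_s]
  · intro F' _ hne
    exact idm_mul_s_of_ne hne.symm U
  · exact fun h => absurd hF h

theorem idSum_mul_idSum {T T' : Finset K} (h : T ⊆ T') :
    idSum ℓ T' * idSum ℓ T = idSum ℓ T := by
  conv_lhs => rw [idSum.eq_1 ℓ T, Finset.mul_sum]
  exact Finset.sum_congr rfl fun G hG => idSum_mul_s (h hG) _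

theorem exists_idSum_mul (a : Lam ℓ K) : ∃ T : Finset K, idSum ℓ T * a = a := by
  have key : ∃ T : Finset K, ∀ T', T ⊆ T' → idSum ℓ T' * a = a := by
    induction a using induction_s with
    | h0 => exact ⟨∅, fun T' _ => mul_zero _⟩
    | hadd x y hx hy =>
      obtain ⟨T1, h1⟩ := hx
      obtain ⟨T2, h2⟩ := hy
      refine ⟨T1 ∪ T2, fun T' h => ?_⟩
      rw [mul_add, h1 T' (Finset.union_subset_left h), h2 T' (Finset.union_subset_right h)]
    | hs c F G U =>
      refine ⟨{F}, fun T' h => ?_⟩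
      rw [mul_smul_comm, idSum_mul_s (h (Finset.mem_singleton_self F))]
  obtain ⟨T, hT⟩ := key
  exact ⟨T, hT T subset_rfl⟩

/-- The inclusion of morphisms for `K ⊆ K'`. -/
def morIncl (h : K ⊆ K') (U : Mor K) : Mor K' :=
  ⟨⟨U.cod.1, h U.cod.2⟩, ⟨U.dom.1, h U.dom.2⟩, U.sub⟩

/-- The inclusion of `Λ_K` in `Λ_{K'}` as a linear map, for `K ⊆ K'`. -/
def inclLin (ℓ : ℕ+ →* 𝕂ˣ) (h : K ⊆ K') : Lam ℓ K →ₗ[𝕂] Lam ℓ K' :=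
  (basis ℓ K).constr 𝕂 fun U => basis ℓ K' (morIncl h U)

theorem inclLin_s (h : K ⊆ K') {F G : K} (U : Subgroup (F.1 × G.1)) :
    inclLin ℓ h (s ℓ U) =
      s ℓ (F := ⟨F.1, h F.2⟩) (G := ⟨G.1, h G.2⟩) U := by
  simp [inclLin, s, morIncl]

/-- The embedding of `Λ_K` in `Λ_{K'}`, for `K ⊆ K'`. -/
def incl (ℓ : ℕ+ →* 𝕂ˣ) (h : K ⊆ K') : Lam ℓ K →ₙ+* Lam ℓ K' where
  toFun := inclLin ℓ h
  map_zero' := map_zero _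
  map_add' := map_add _
  map_mul' a b := by
    induction a using induction_s with
    | h0 => simp only [zero_mul, map_zero]
    | hadd x y hx hy => simp only [add_mul, map_add, hx, hy]
    | hs c F G U =>
      induction b using induction_s with
      | h0 => simp only [mul_zero, map_zero]
      | hadd x y hx hy => simp only [mul_add, map_add, hx, hy]
      | hs d G' H V =>
        simp only [smul_mul_assoc, mul_smul_comm, map_smul]
        congr 2
        by_cases hG : G' = G
        · subst hG
          rw [s_mul_s, map_smul, inclLin_s, inclLin_s, inclLin_s, s_mul_s]
        · rw [s_mul_s_of_ne hG, map_zero, inclLin_s, inclLin_s, s_mul_s_of_ne]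
          intro hne
          exact hG (Subtype.ext (Subtype.mk.inj hne))

/-- The map `μ_G` to `End_Λ(G)` from `𝕂 Aut(G)`, sending `θ` to `s_{Δ(θ)}`. -/
def mu (ℓ : ℕ+ →* 𝕂ˣ) (G : K) (x : MonoidAlgebra 𝕂 (MulAut G.1)) : Lam ℓ K :=
  x.coeff.sum fun θ c => c • s ℓ (graph θ)

/-- The map `μ_φ` to `End_Λ(G)` from `𝕂 Aut(E)`, for `Y ⊴ B ≤ G` and an isomorphism `φ` to `E` from
`B / Y`, sending `ε` to `ℓ(Y)⁻¹ s_{Δ(B, Y, φ⁻¹ ε φ, Y, B)}`. -/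
def muPhi (ℓ : ℕ+ →* 𝕂ˣ) {E : FiniteGrp.{u}} (G : K) (B : Subgroup G.1) (Y : Subgroup B) [Y.Normal]
    (φ : B ⧸ Y ≃* E) (x : MonoidAlgebra 𝕂 (MulAut E)) : Lam ℓ K :=
  x.coeff.sum fun ε c =>
    c • (ell ℓ Y)⁻¹ • s ℓ (F := G) (G := G) (goursat B Y B Y ((φ.trans ε).trans φ.symm))

end Lam

/-! ### Modules of locally unital rings -/

/-- A module of a locally unital (not necessarily unital) ring: every element is fixed by an
idempotent. -/
structure LUModule (A : Type*) [NonUnitalRing A] where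
  carrier : Type k
  [addCommGroup : AddCommGroup carrier]
  act : A →ₙ+* AddMonoid.End carrier
  exists_idem : ∀ m : carrier, ∃ e : A, e * e = e ∧ act e m = m

attribute [instance] LUModule.addCommGroup

namespace LUModule

variable {A : Type*} [NonUnitalRing A]

/-- Isomorphism of modules. -/
def Iso (M N : LUModule.{k} A) : Prop :=
  ∃ f : M.carrier ≃+ N.carrier, ∀ a m, f (M.act a m) = N.act a (f m)

/-- A module is simple if it is nonzero and has no submodules besides zero and itself. -/
def IsSimple (M : LUModule.{k} A) : Prop :=
  Nontrivial M.carrier ∧ ∀ N : AddSubgroup M.carrier,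
    (∀ a, ∀ n ∈ N, M.act a n ∈ N) → N = ⊥ ∨ N = ⊤

theorem Iso.equivalence : Equivalence (Iso (A := A)) where
  refl M := ⟨AddEquiv.refl _, fun _ _ => rfl⟩
  symm := by
    rintro M N ⟨f, hf⟩
    refine ⟨f.symm, fun a m => ?_⟩
    rw [AddEquiv.symm_apply_eq, hf, AddEquiv.apply_symm_apply]
  trans := by
    rintro M N P ⟨f, hf⟩ ⟨g, hg⟩
    refine ⟨f.trans g, fun a m => ?_⟩
    simp [hf, hg]

end LUModule

/-- The simple modules of a locally unital ring. -/
def SimpleModule (A : Type*) [NonUnitalRing A] : Type _ := {M : LUModule.{k} A // M.IsSimple}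

/-- Isomorphism of simple modules, as an equivalence relation. -/
instance SimpleModule.setoid (A : Type*) [NonUnitalRing A] : Setoid (SimpleModule.{k} A) where
  r M N := M.1.Iso N.1
  iseqv := ⟨fun M => LUModule.Iso.equivalence.refl M.1, fun h => LUModule.Iso.equivalence.symm h,
    fun h h' => LUModule.Iso.equivalence.trans h h'⟩

section LamModules

variable {𝕂 : Type k} [Field 𝕂] {ℓ : ℕ+ →* 𝕂ˣ} {K K' : Set FiniteGrp.{u}}

/-- The type of `Λ`-modules, with underlying sets in the universe of `Λ` (every simple
`Λ`-module is isomorphic to a quotient of a left ideal of `Λ`). -/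
abbrev LamModule (ℓ : ℕ+ →* 𝕂ˣ) (K : Set FiniteGrp.{u}) : Type _ :=
  LUModule.{max k (u + 1)} (Lam ℓ K)

/-- The type of simple `Λ`-modules. -/
abbrev SimpleLamModule (ℓ : ℕ+ →* 𝕂ˣ) (K : Set FiniteGrp.{u}) : Type _ :=
  SimpleModule.{max k (u + 1)} (Lam ℓ K)

namespace LamModule

/-- The evaluation `M(G) = id_G M`. -/
def eval (M : LamModule ℓ K) (G : K) : AddSubgroup M.carrier := (M.act (Lam.idm ℓ G)).range

/-- For `K ⊆ K'` and a `Λ_{K'}`-module `M`, the additive subgroup `Λ_K M` of `M` generated by the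
elements `a m` with `a ∈ Λ_K` and `m ∈ M`. -/
def cornerSubgroup (h : K ⊆ K') (M : LamModule ℓ K') : AddSubgroup M.carrier :=
  AddSubgroup.closure {x | ∃ (a : Lam ℓ K) (m : M.carrier), M.act (Lam.incl ℓ h a) m = x}

theorem act_mem_cornerSubgroup (h : K ⊆ K') (M : LamModule ℓ K') (a : Lam ℓ K) (m : M.carrier) :
    M.act (Lam.incl ℓ h a) m ∈ cornerSubgroup h M :=
  AddSubgroup.subset_closure ⟨a, m, rfl⟩

theorem act_act (h : K ⊆ K') (M : LamModule ℓ K') (a b : Lam ℓ K) (m : M.carrier) :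
    M.act (Lam.incl ℓ h a) (M.act (Lam.incl ℓ h b) m) = M.act (Lam.incl ℓ h (a * b)) m := by
  rw [map_mul, map_mul]
  rfl

theorem exists_idSum_act (h : K ⊆ K') (M : LamModule ℓ K') (x : M.carrier)
    (hx : x ∈ cornerSubgroup h M) :
    ∃ T : Finset K, M.act (Lam.incl ℓ h (Lam.idSum ℓ T)) x = x := by
  have mono : ∀ {T T' : Finset K} {y : M.carrier}, T ⊆ T' →
      M.act (Lam.incl ℓ h (Lam.idSum ℓ T)) y = y →
      M.act (Lam.incl ℓ h (Lam.idSum ℓ T')) y = y := by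
    intro T T' y hT hy
    conv_lhs => rw [← hy]
    rw [act_act, Lam.idSum_mul_idSum hT, hy]
  induction hx using AddSubgroup.closure_induction with
  | mem y hy =>
    obtain ⟨a, m, rfl⟩ := hy
    obtain ⟨T, hT⟩ := Lam.exists_idSum_mul a
    refine ⟨T, ?_⟩
    rw [act_act, hT]
  | zero => exact ⟨∅, map_zero _⟩
  | add y z _ _ hy hz =>
    obtain ⟨T1, h1⟩ := hy
    obtain ⟨T2, h2⟩ := hz
    refine ⟨T1 ∪ T2, ?_⟩
    rw [map_add, mono Finset.subset_union_left h1, mono Finset.subset_union_right h2]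
  | neg y _ hy =>
    obtain ⟨T, hT⟩ := hy
    exact ⟨T, by rw [map_neg, hT]⟩

/-- For `K ⊆ K'` and a `Λ_{K'}`-module `M`, the `Λ_K`-module `Λ_K M`. -/
def corner (h : K ⊆ K') (M : LamModule ℓ K') : LamModule ℓ K where
  carrier := cornerSubgroup h M
  act :=
    { toFun := fun a =>
        ((M.act (Lam.incl ℓ h a)).comp (cornerSubgroup h M).subtype).codRestrict
          (cornerSubgroup h M) fun m => act_mem_cornerSubgroup h M a m
      map_zero' := by
        ext m
        exact congrArg (fun g : AddMonoid.End M.carrier => g m) ((M.act.comp (Lam.incl ℓ h)).map_zero)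
      map_add' := fun a b => by
        ext m
        exact congrArg (fun g : AddMonoid.End M.carrier => g m)
          ((M.act.comp (Lam.incl ℓ h)).map_add a b)
      map_mul' := fun a b => by
        ext m
        exact congrArg (fun g : AddMonoid.End M.carrier => g m)
          ((M.act.comp (Lam.incl ℓ h)).map_mul a b) }
  exists_idem := by
    rintro ⟨x, hx⟩
    obtain ⟨T, hT⟩ := exists_idSum_act h M x hx
    exact ⟨Lam.idSum ℓ T, Lam.idSum_mul_idSum subset_rfl, Subtype.ext hT⟩

end LamModule

end LamModules

/-! ### Seeds -/

/-- An `𝒮`-seed `(E, W)` for `K`: a factor group `E` of an element of `K`, and a simple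
`𝕂 Aut(E)`-module `W`. -/
structure Seed (𝕂 : Type k) [Field 𝕂] (K : Set FiniteGrp.{u}) where
  E : FiniteGrp.{u}
  isFactor : ∃ G ∈ K, IsFactorGroup E G
  W : Type k
  [addCommGroup : AddCommGroup W]
  [module : Module (MonoidAlgebra 𝕂 (MulAut E)) W]
  [simple : IsSimpleModule (MonoidAlgebra 𝕂 (MulAut E)) W]

attribute [instance] Seed.addCommGroup Seed.module Seed.simple

namespace Seed

variable {𝕂 : Type k} [Field 𝕂] {ℓ : ℕ+ →* 𝕂ˣ} {K K' : Set FiniteGrp.{u}}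

/-- The isomorphism to `𝕂 Aut(E)` from `𝕂 Aut(E')` induced by an isomorphism to `E` from `E'`. -/
def autIso (𝕂 : Type k) [Field 𝕂] {E E' : FiniteGrp.{u}} (θ : E' ≃* E) :
    MonoidAlgebra 𝕂 (MulAut E') ≃ₐ[𝕂] MonoidAlgebra 𝕂 (MulAut E) :=
  MonoidAlgebra.domCongr 𝕂 𝕂 (MulAut.congr θ)

/-- Seeds `(E, W)` and `(E', W')` are equivalent if there is an isomorphism `θ` to `E` from `E'`
with `W` isomorphic to the transport of `W'` along `θ`. -/
def Equivalent (p p' : Seed 𝕂 K) : Prop :=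
  ∃ (θ : p'.E ≃* p.E) (f : p'.W ≃+ p.W), ∀ x w, f (x • w) = autIso 𝕂 θ x • f w

theorem Equivalent.equivalence : Equivalence (Equivalent (𝕂 := 𝕂) (K := K)) where
  refl p := by
    refine ⟨MulEquiv.refl _, AddEquiv.refl _, fun x w => ?_⟩
    have h : autIso 𝕂 (MulEquiv.refl p.E) x = x := by
      have h1 : MulAut.congr (MulEquiv.refl p.E) = MulEquiv.refl (MulAut p.E) := by
        ext
        rfl
      simp [autIso, h1]
    rw [h]
    rfl
  symm := by
    rintro p p' ⟨θ, f, hf⟩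
    refine ⟨θ.symm, f.symm, fun x w => ?_⟩
    rw [AddEquiv.symm_apply_eq, hf, AddEquiv.apply_symm_apply]
    congr 1
    exact ((autIso 𝕂 θ).apply_symm_apply x).symm
  trans := by
    rintro p p' p'' ⟨θ, f, hf⟩ ⟨η, g, hg⟩
    refine ⟨η.trans θ, g.trans f, fun x w => ?_⟩
    have h : autIso 𝕂 (η.trans θ) x = autIso 𝕂 θ (autIso 𝕂 η x) := by
      have h1 : MulAut.congr (η.trans θ) = (MulAut.congr η).trans (MulAut.congr θ) := by
        ext
        rfl
      simp only [autIso, h1]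
      ext y
      simp
    simp [hf, hg, h]

/-- Equivalence of seeds, as an equivalence relation. -/
instance setoid (𝕂 : Type k) [Field 𝕂] (K : Set FiniteGrp.{u}) : Setoid (Seed 𝕂 K) where
  r := Equivalent
  iseqv := Equivalent.equivalence

/-- A seed for `K` is a seed for any larger `K'`. -/
def mono (h : K ⊆ K') (p : Seed 𝕂 K) : Seed 𝕂 K' where
  E := p.E
  isFactor := let ⟨G, hG, hE⟩ := p.isFactor; ⟨G, h hG, hE⟩
  W := p.W

/-- For a seed `(E, W)` with `E ∈ K`: the class `[E]` is minimal subject to `M(E) ≠ 0`, and `W` is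
isomorphic to the restriction of `M(E)` via `μ_E`. -/
def MinimalIn (p : Seed 𝕂 K) (hE : p.E ∈ K) (M : LamModule ℓ K) : Prop :=
  M.eval ⟨p.E, hE⟩ ≠ ⊥ ∧
  (∀ F : K, M.eval F ≠ ⊥ → IsFactorGroup F.1 p.E → IsFactorGroup p.E F.1) ∧
  ∃ f : p.W ≃+ M.eval ⟨p.E, hE⟩, ∀ x w, (f (x • w) : M.carrier) = M.act (Lam.mu ℓ ⟨p.E, hE⟩ x) (f w)

/-- The correspondence between simple `Λ`-modules and seeds when `K` is closed under factor groups
up to isomorphism: some seed `(E, W)` equivalent to `p` has `E ∈ K`, `[E]` minimal subject to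
`M(E) ≠ 0`, and `W` isomorphic to `M(E)`. -/
def Corresponds (p : Seed 𝕂 K) (M : LamModule ℓ K) : Prop :=
  ∃ (q : Seed 𝕂 K) (hE : q.E ∈ K), p.Equivalent q ∧ q.MinimalIn hE M

/-- `M` is isomorphic to `S_{E, W}` as constructed using `K' ⊇ K`, where `p = (E, W)`: it is
isomorphic to `Λ_K S'`, where `S'` is the simple `Λ_{K'}`-module corresponding to `(E, W)`. -/
def IsSeedModuleVia (h : K ⊆ K') (p : Seed 𝕂 K) (M : LamModule ℓ K) : Prop :=
  ∃ S' : SimpleLamModule ℓ K', (p.mono h).Corresponds S'.1 ∧ M.Iso (LamModule.corner h S'.1)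

/-- Condition (a): for `G ∈ K`, we have `M(G) ≠ 0` if and only if `[E] ≤ [G]`. -/
def CondA (p : Seed 𝕂 K) (M : LamModule ℓ K) : Prop :=
  ∀ G : K, M.eval G ≠ ⊥ ↔ IsFactorGroup p.E G.1

/-- Condition (b): for `Y ⊴ B ≤ G ∈ K`, an isomorphism `φ` to `E` from `B / Y`, and an idempotent
`x` of `𝕂 Aut(E)`, we have `μ_φ(x) M(G) ≠ 0` if and only if `x W ≠ 0`. -/
def CondB (p : Seed 𝕂 K) (M : LamModule ℓ K) : Prop :=
  ∀ (G : K) (B : Subgroup G.1) (Y : Subgroup B) [Y.Normal] (φ : B ⧸ Y ≃* p.E)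
    (x : MonoidAlgebra 𝕂 (MulAut p.E)), IsIdempotentElem x →
      ((∃ m ∈ M.eval G, M.act (Lam.muPhi ℓ G B Y φ x) m ≠ 0) ↔ ∃ w : p.W, x • w ≠ 0)

/-- Condition (c): `[E] ≤ [E']` for every seed `(E', W')` satisfying (a) and (b). -/
def CondC (p : Seed 𝕂 K) (M : LamModule ℓ K) : Prop :=
  ∀ p' : Seed 𝕂 K, p'.CondA M → p'.CondB M → IsFactorGroup p.E p'.E

end Seed

end SubgroupCat

end

noncomputable section

open scoped Classical

namespace SubgroupCat

/-! ### Graphs of isomorphisms and sections of finite groups -/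

section Groups

variable {R S T : Type*} [Group R] [Group S] [Group T]

/-! Everything is compared with the algebra of all finite groups. Write `Λ'` for the algebra of a
larger set `K'`. Since `id_F Λ' id_G` lies in `Λ_K` for `F, G ∈ K`, the corner `Λ_K T` of a simple
`Λ'`-module `T` is zero or simple. Conversely, every simple `Λ_K`-module is such a corner
(`exists_extension`). Hence it suffices to understand simple modules over an algebra closed under
factor groups.

Let `T` be simple over such an algebra and let `[E]` be minimal with `T(E) ≠ 0`. By Goursat, an
endomorphism of `E` in the subgroup category that is not an automorphism factors through a proper
section of `E`, where `T` vanishes, so it kills `T(E)` (`pure_of_minimal`). Therefore `id_E a` acts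
on `T(E)` as the image of `a` in `𝕂 Aut(E)` (`Pure.act_eq`). Consequently `T(E)` is a simple `𝕂
Aut(E)`-module, it determines `T` (`MinimalIn.iso`), and `[E]` is least, not only minimal
(`Pure.isFactorGroup`). Every simple `W` occurs: inflate it to the algebra of `{E}` alone and extend
(`exists_minimalIn`).

For the intrinsic conditions, `μ_φ(k)` is inflation after `k` after deflation, and deflation after
inflation is the nonzero scalar `ℓ(Y)`. So `μ_φ(k)` is nonzero on `S(G)` exactly when `k` is nonzero
on `W`, which gives (a) and (b) for the true seed. If another seed satisfies (b), taking `k = 1`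
shows that `T` is nonzero at its group, so `[E]` is a factor of it, which is (c). When that seed
also satisfies (c), the two groups are isomorphic, and (b) says that every idempotent nonzero on `W`
is nonzero on the other module. By Maschke's theorem `𝕂 Aut(E)` is semisimple, so such idempotents
identify the simple module (`exists_equiv_of_idempotents`). -/

theorem graph_injective : Function.Injective (graph : (S ≃* R) → Subgroup (R × S)) := by
  intro θ η h
  ext s
  have : (θ s, s) ∈ graph η := h ▸ mem_graph.2 rfl
  exact mem_graph.1 this

theorem star_graph_refl (U : Subgroup (R × S)) : star U (graph (MulEquiv.refl S)) = U := by
  ext ⟨r, s⟩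
  simp [mem_star, mem_graph]

theorem star_graph_graph (θ : S ≃* R) (η : T ≃* S) :
    star (graph θ) (graph η) = graph (η.trans θ) := by
  ext ⟨r, t⟩
  simp [mem_star, mem_graph]

theorem rightKer_graph (θ : S ≃* R) : rightKer (graph θ) = ⊥ := by
  ext s
  rw [mem_rightKer, mem_graph, eq_comm, Subgroup.mem_bot, EmbeddingLike.map_eq_one_iff]

theorem leftKer_graph (θ : S ≃* R) : leftKer (graph θ) = ⊥ := by
  ext s
  simp [mem_leftKer, mem_graph]

/-- A subgroup of `R × S` which projects onto `S` and meets `R` and `S` trivially is the graph of an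
isomorphism once `R` has the same order as `S`. -/
theorem exists_eq_graph [Finite R] [Finite S] (hcard : Nat.card R ≤ Nat.card S)
    (U : Subgroup (R × S)) (hl : ∀ r, (r, (1 : S)) ∈ U → r = 1) (hs : ∀ s, ∃ r, (r, s) ∈ U)
    (hr : ∀ s, ((1 : R), s) ∈ U → s = 1) : ∃ θ : S ≃* R, U = graph θ := by
  choose f hf using hs
  have huniq : ∀ r s, (r, s) ∈ U → r = f s := by
    intro r s h
    have h1 := U.mul_mem h (U.inv_mem (hf s))
    simp only [Prod.inv_mk, Prod.mk_mul_mk, mul_inv_cancel] at h1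
    exact mul_inv_eq_one.1 (hl _ h1)
  let F : S →* R :=
    { toFun := f
      map_one' := (huniq 1 1 U.one_mem).symm
      map_mul' := fun s t => (huniq _ _ (U.mul_mem (hf s) (hf t))).symm }
  have hinj : Function.Injective F := by
    rw [injective_iff_map_eq_one]
    intro s hs
    refine hr s ?_
    have := hf s
    change F s = 1 at hs
    change (F s, s) ∈ U at this
    rwa [hs] at this
  have hbij : Function.Bijective F :=
    hinj.bijective_of_nat_card_le hcard
  refine ⟨MulEquiv.ofBijective F hbij, ?_⟩
  ext ⟨r, s⟩
  rw [mem_graph]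
  refine ⟨huniq r s, fun h => ?_⟩
  change r = f s at h
  rw [h]
  exact hf s

/-- Triviality of the other kernel comes from finiteness: choosing a partner for each `s` is
injective, hence surjective, and reading `U` backwards gives a surjective endomorphism of `S`, which
is then injective. -/
theorem exists_eq_graph' [Finite S] (U : Subgroup (S × S))
    (hs : ∀ s, ∃ r, (r, s) ∈ U) (hr : ∀ s, ((1 : S), s) ∈ U → s = 1) :
    ∃ θ : S ≃* S, U = graph θ := by
  choose f hf using hs
  have hinj : Function.Injective f := by
    intro s t h
    have h1 := U.mul_mem (hf s) (U.inv_mem (hf t))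
    simp only [Prod.inv_mk, Prod.mk_mul_mk, h, mul_inv_cancel] at h1
    exact mul_inv_eq_one.1 (hr _ h1)
  have hsurj := Finite.surjective_of_injective hinj
  refine exists_eq_graph le_rfl U ?_ (fun s => ⟨_, hf s⟩) hr
  let F : S →* S := MonoidHom.mk' (fun r => (hsurj r).choose) (by
    intro a b
    have ha := hf (hsurj a).choose
    have hb := hf (hsurj b).choose
    have hab := hf (hsurj (a * b)).choose
    rw [(hsurj a).choose_spec] at ha
    rw [(hsurj b).choose_spec] at hb
    rw [(hsurj (a * b)).choose_spec] at hab
    have h1 := U.mul_mem hab (U.inv_mem (U.mul_mem ha hb))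
    simp only [Prod.inv_mk, Prod.mk_mul_mk, mul_inv_cancel] at h1
    exact mul_inv_eq_one.1 (hr _ h1))
  have hFU : ∀ r, (r, F r) ∈ U := by
    intro r
    have ha := hf (hsurj r).choose
    rwa [(hsurj r).choose_spec] at ha
  have hFsurj : Function.Surjective F := by
    intro s
    refine ⟨f s, ?_⟩
    have h1 := U.mul_mem (hFU (f s)) (U.inv_mem (hf s))
    simp only [Prod.inv_mk, Prod.mk_mul_mk, mul_inv_cancel] at h1
    exact mul_inv_eq_one.1 (hr _ h1)
  have hFinj := Finite.injective_iff_surjective.2 hFsurj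
  intro r h
  apply hFinj
  rw [map_one]
  have h1 := U.mul_mem (hFU r) (U.inv_mem h)
  simp only [Prod.inv_mk, Prod.mk_mul_mk, mul_inv_cancel, inv_one, mul_one] at h1
  exact hr _ h1

theorem exists_eq_graph_of_fst [Finite S] (U : Subgroup (S × S))
    (hs : ∀ r, ∃ s, (r, s) ∈ U) (hl : ∀ r, (r, (1 : S)) ∈ U → r = 1) :
    ∃ θ : S ≃* S, U = graph θ := by
  obtain ⟨θ, hθ⟩ := exists_eq_graph' (U.map (MulEquiv.prodComm (M := S) (N := S)).toMonoidHom)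
    (fun s => by
      obtain ⟨r, h⟩ := hs s
      exact ⟨r, ⟨(s, r), h, rfl⟩⟩)
    (fun s h => by
      obtain ⟨⟨a, b⟩, hab, he⟩ := h
      obtain ⟨rfl, rfl⟩ := Prod.mk.inj he
      exact hl _ hab)
  refine ⟨θ.symm, ?_⟩
  ext ⟨r, s⟩
  rw [mem_graph, MulEquiv.eq_symm_apply, eq_comm, ← mem_graph (θ := θ), ← hθ]
  constructor
  · exact fun h => ⟨(r, s), h, rfl⟩
  · rintro ⟨⟨a, b⟩, hab, he⟩
    obtain ⟨rfl, rfl⟩ := Prod.mk.inj he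
    exact hab

/-- With its companion for the right factor, this makes the span of the non-automorphisms of a
finite group a two-sided ideal in the span of its endomorphisms. -/
theorem graph_left_of_star_eq_graph [Finite S] {U V : Subgroup (S × S)} {θ : S ≃* S}
    (h : star U V = graph θ) : ∃ η : S ≃* S, U = graph η := by
  refine exists_eq_graph_of_fst U (fun r => ?_) (fun r hr => ?_)
  · have : (r, θ.symm r) ∈ star U V := h ▸ mem_graph.2 (by simp)
    obtain ⟨s, hs, -⟩ := this
    exact ⟨s, hs⟩
  · have : (r, (1 : S)) ∈ star U V := ⟨1, hr, V.one_mem⟩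
    rw [h, mem_graph, map_one] at this
    exact this

theorem graph_right_of_star_eq_graph [Finite S] {U V : Subgroup (S × S)} {θ : S ≃* S}
    (h : star U V = graph θ) : ∃ η : S ≃* S, V = graph η := by
  refine exists_eq_graph' V (fun s => ?_) (fun s hs => ?_)
  · have : (θ s, s) ∈ star U V := h ▸ mem_graph.2 rfl
    obtain ⟨r, -, hr⟩ := this
    exact ⟨r, hr⟩
  · have : ((1 : S), s) ∈ star U V := ⟨1, U.one_mem, hs⟩
    rw [h, mem_graph] at this
    exact (map_eq_one_iff θ θ.injective).1 this.symm

/-- If the identity-like morphism `Δ(θ)` on `S` factors through `T`, then `S` is a factor group of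
`T`. -/
theorem isFactorGroup_of_star_eq_graph {U : Subgroup (R × T)} {V : Subgroup (T × S)}
    {θ : S ≃* R} (h : star U V = graph θ) : IsFactorGroup S T := by
  -- These are the elements of `T` through which the composite can pass; on them `V` is a
  -- single-valued homomorphism to `S`, because its right kernel would embed in that of the graph.
  let B : Subgroup T := U.map (MonoidHom.snd R T) ⊓ V.map (MonoidHom.fst T S)
  have hBl : ∀ t : B, ∃ r, (r, t.1) ∈ U := by
    rintro ⟨t, ⟨⟨r, t'⟩, hr, rfl⟩, -⟩
    exact ⟨r, hr⟩
  have hBr : ∀ t : B, ∃ s, (t.1, s) ∈ V := by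
    rintro ⟨t, -, ⟨⟨t', s⟩, hr, rfl⟩⟩
    exact ⟨s, hr⟩
  choose g hg using hBr
  have hker : ∀ s, ((1 : T), s) ∈ V → s = 1 := by
    intro s hs
    have : ((1 : R), s) ∈ star U V := ⟨1, U.one_mem, hs⟩
    rw [h, mem_graph] at this
    exact (map_eq_one_iff θ θ.injective).1 this.symm
  have huniq : ∀ (t : B) s, (t.1, s) ∈ V → s = g t := by
    intro t s hs
    have h1 := V.mul_mem hs (V.inv_mem (hg t))
    simp only [Prod.inv_mk, Prod.mk_mul_mk, mul_inv_cancel] at h1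
    exact mul_inv_eq_one.1 (hker _ h1)
  let f : B →* S :=
    { toFun := g
      map_one' := (huniq 1 1 V.one_mem).symm
      map_mul' := fun s t => (huniq _ _ (V.mul_mem (hg s) (hg t))).symm }
  have hsurj : Function.Surjective f := by
    intro s
    have : (θ s, s) ∈ star U V := h ▸ mem_graph.2 rfl
    obtain ⟨t, h1, h2⟩ := this
    exact ⟨⟨t, ⟨_, h1, rfl⟩, ⟨_, h2, rfl⟩⟩, (huniq _ _ h2).symm⟩
  exact ⟨B, f.ker, inferInstance, ⟨QuotientGroup.quotientKerEquivOfSurjective f hsurj⟩⟩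

theorem IsFactorGroup.card_le [Finite S] (h : IsFactorGroup R S) : Nat.card R ≤ Nat.card S := by
  obtain ⟨B, Y, _, ⟨φ⟩⟩ := h
  rw [← Nat.card_congr φ.toEquiv]
  exact (Nat.card_le_card_of_surjective _ (QuotientGroup.mk'_surjective Y)).trans
    (Subgroup.card_le_card_group B)

theorem IsFactorGroup.of_mulEquiv (e : R ≃* S) : IsFactorGroup R S :=
  ⟨⊤, ⊥, inferInstance,
    ⟨(QuotientGroup.quotientBot.trans Subgroup.topEquiv).trans e.symm⟩⟩

theorem IsFactorGroup.congr_left (h : IsFactorGroup R S) (e : R ≃* T) : IsFactorGroup T S := by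
  obtain ⟨B, Y, hY, ⟨φ⟩⟩ := h
  exact ⟨B, Y, hY, ⟨φ.trans e⟩⟩

theorem subquotient_card_eq [Finite S] {B : Subgroup S} {Y : Subgroup B} [Y.Normal]
    (h : Nat.card S ≤ Nat.card (B ⧸ Y)) : B = ⊤ ∧ Y = ⊥ := by
  have h1 := Nat.card_le_card_of_surjective _ (QuotientGroup.mk'_surjective Y)
  have h2 := Subgroup.card_le_card_group B
  have hB : Nat.card B = Nat.card S := by omega
  refine ⟨Subgroup.eq_top_of_card_eq B hB, ?_⟩
  have h3 := Subgroup.card_eq_card_quotient_mul_card_subgroup Y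
  have h4 : Nat.card (B ⧸ Y) = Nat.card B := by omega
  rw [h4] at h3
  have : 0 < Nat.card B := Nat.card_pos
  apply Subgroup.eq_bot_of_card_eq
  nlinarith

theorem IsFactorGroup.mulEquiv_of_card_le [Finite S] (h : IsFactorGroup R S)
    (hc : Nat.card S ≤ Nat.card R) : Nonempty (R ≃* S) := by
  obtain ⟨B, Y, _, ⟨φ⟩⟩ := h
  obtain ⟨hB, hY⟩ := subquotient_card_eq (B := B) (Y := Y)
    (hc.trans_eq (Nat.card_congr φ.toEquiv).symm)
  subst hY hB
  exact ⟨φ.symm.trans (QuotientGroup.quotientBot.trans Subgroup.topEquiv)⟩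

/-- The morphism `{(b, φ(bY))}` to `S` from `R`, for `φ : B / Y ≅ R`. -/
def inf (B : Subgroup S) (Y : Subgroup B) [Y.Normal] (φ : B ⧸ Y ≃* R) : Subgroup (S × R) :=
  (B.subtype.prod (φ.toMonoidHom.comp (QuotientGroup.mk' Y))).range

/-- The morphism `{(φ(bY), b)}` to `R` from `S`, for `φ : B / Y ≅ R`. -/
def defl (B : Subgroup S) (Y : Subgroup B) [Y.Normal] (φ : B ⧸ Y ≃* R) : Subgroup (R × S) :=
  ((φ.toMonoidHom.comp (QuotientGroup.mk' Y)).prod B.subtype).range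

/-! ### Inflation and deflation through a section -/

section InfDefl

variable (B : Subgroup S) (Y : Subgroup B) [Y.Normal] (φ : B ⧸ Y ≃* R)

theorem mem_inf {s : S} {r : R} : (s, r) ∈ inf B Y φ ↔ ∃ b : B, b.1 = s ∧ φ (b : B ⧸ Y) = r := by
  simp [inf, MonoidHom.mem_range]

theorem mem_defl {s : S} {r : R} :
    (r, s) ∈ defl B Y φ ↔ ∃ b : B, b.1 = s ∧ φ (b : B ⧸ Y) = r := by
  simp only [defl, MonoidHom.mem_range, MonoidHom.prod_apply, Prod.mk.injEq]
  exact exists_congr fun b => and_comm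

theorem rightKer_inf : rightKer (inf B Y φ) = ⊥ := by
  ext r
  rw [mem_rightKer, mem_inf, Subgroup.mem_bot]
  constructor
  · rintro ⟨b, hb, rfl⟩
    obtain rfl : b = 1 := Subtype.ext hb
    simp
  · rintro rfl
    exact ⟨1, rfl, by simp⟩

theorem leftKer_defl : leftKer (defl B Y φ) = ⊥ := by
  ext r
  rw [mem_leftKer, mem_defl, Subgroup.mem_bot]
  constructor
  · rintro ⟨b, hb, rfl⟩
    obtain rfl : b = 1 := Subtype.ext hb
    simp
  · rintro rfl
    exact ⟨1, rfl, by simp⟩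

theorem leftKer_inf : leftKer (inf B Y φ) = Y.map B.subtype := by
  ext s
  rw [mem_leftKer, mem_inf, Subgroup.mem_map]
  simp only [EmbeddingLike.map_eq_one_iff, QuotientGroup.eq_one_iff, Subgroup.subtype_apply]
  exact exists_congr fun b => and_comm

theorem rightKer_defl : rightKer (defl B Y φ) = Y.map B.subtype := by
  ext s
  rw [mem_rightKer, mem_defl, Subgroup.mem_map]
  simp only [EmbeddingLike.map_eq_one_iff, QuotientGroup.eq_one_iff, Subgroup.subtype_apply]
  exact exists_congr fun b => and_comm

theorem defl_star_inf : star (defl B Y φ) (inf B Y φ) = graph (MulEquiv.refl R) := by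
  ext ⟨r, r'⟩
  simp only [mem_star, mem_defl, mem_inf, mem_graph, MulEquiv.refl_apply]
  constructor
  · rintro ⟨_, ⟨b, rfl, rfl⟩, c, hc, rfl⟩
    rw [Subtype.ext hc]
  · rintro rfl
    obtain ⟨b, hb⟩ := QuotientGroup.mk_surjective (φ.symm r)
    exact ⟨b, ⟨b, rfl, by simp [hb]⟩, b, rfl, by simp [hb]⟩

theorem mem_goursat (X : Subgroup B) [X.Normal] (θ : B ⧸ Y ≃* B ⧸ X) {s s' : S} :
    (s, s') ∈ goursat B X B Y θ ↔
      ∃ b c : B, (b : B ⧸ X) = θ (c : B ⧸ Y) ∧ b.1 = s ∧ c.1 = s' := by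
  constructor
  · rintro ⟨⟨b, c⟩, h, he⟩
    obtain ⟨rfl, rfl⟩ := Prod.mk.inj he
    exact ⟨b, c, h, rfl, rfl⟩
  · rintro ⟨b, c, h, rfl, rfl⟩
    exact ⟨(b, c), h, rfl⟩

theorem inf_star_graph_star_defl (ε : R ≃* R) :
    star (star (inf B Y φ) (graph ε)) (defl B Y φ) =
      goursat B Y B Y ((φ.trans ε).trans φ.symm) := by
  ext ⟨s, s'⟩
  simp only [mem_star, mem_defl, mem_inf, mem_graph, mem_goursat]
  constructor
  · rintro ⟨r, ⟨r', ⟨b, rfl, h1⟩, rfl⟩, c, rfl, rfl⟩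
    refine ⟨b, c, ?_, rfl, rfl⟩
    simp [← h1]
  · rintro ⟨b, c, h, rfl, rfl⟩
    refine ⟨φ c, ⟨ε (φ c), ⟨b, rfl, ?_⟩, rfl⟩, c, rfl, rfl⟩
    rw [h]
    simp

end InfDefl

/-- The Goursat factorization of `U ≤ T × S` through the section of `S` that it determines. -/
theorem exists_factorization (U : Subgroup (T × S)) :
    ∃ (B : Subgroup S) (Y : Subgroup B) (_ : Y.Normal),
      (∀ s, s ∈ B ↔ ∃ t, (t, s) ∈ U) ∧ (∀ b : B, b ∈ Y ↔ ((1 : T), b.1) ∈ U) ∧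
      ∀ {R : Type u} [Group R] (φ : B ⧸ Y ≃* R), star (star U (inf B Y φ)) (defl B Y φ) = U := by
  let B : Subgroup S := U.map (MonoidHom.snd T S)
  let Y : Subgroup B := (rightKer U).subgroupOf B
  have hB : ∀ s, s ∈ B ↔ ∃ t, (t, s) ∈ U := by
    intro s
    simp [B, Subgroup.mem_map]
  have hY : ∀ b : B, b ∈ Y ↔ ((1 : T), b.1) ∈ U := fun b => Iff.rfl
  have hN : Y.Normal := by
    refine ⟨fun n hn g => ?_⟩
    obtain ⟨t, ht⟩ := (hB _).1 g.2
    rw [hY] at hn ⊢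
    have := U.mul_mem (U.mul_mem ht hn) (U.inv_mem ht)
    simpa using this
  refine ⟨B, Y, hN, hB, hY, ?_⟩
  intro R _ φ
  ext ⟨t, s⟩
  simp only [mem_star, mem_defl, mem_inf]
  constructor
  -- The passage through `R` only remembers the coset modulo `Y`; the discrepancy lies in the right
  -- kernel of `U` and is absorbed.
  · rintro ⟨r, ⟨s', h, b, rfl, rfl⟩, c, rfl, h2⟩
    have h3 : b⁻¹ * c ∈ Y := QuotientGroup.eq.1 (φ.injective h2).symm
    have := U.mul_mem h ((hY _).1 h3)
    simpa using this
  · intro h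
    have hs : s ∈ B := (hB s).2 ⟨t, h⟩
    exact ⟨_, ⟨s, h, ⟨s, hs⟩, rfl, rfl⟩, ⟨s, hs⟩, rfl, rfl⟩

end Groups

/-! ### Values of the cocycle -/

section Cocycle

variable {𝕂 : Type k} [Field 𝕂] (ℓ : ℕ+ →* 𝕂ˣ)

theorem ell_congr {A B : Type*} [Group A] [Finite A] [Group B] [Finite B]
    (h : Nat.card A = Nat.card B) : ell ℓ A = ell ℓ B := by
  unfold ell
  exact congrArg (fun n => ((ℓ n : 𝕂ˣ) : 𝕂)) (PNat.eq h)

theorem ell_bot {A : Type*} [Group A] [Finite A] : ell ℓ (⊥ : Subgroup A) = 1 := by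
  have h : Nat.toPNat (Nat.card (⊥ : Subgroup A)) Nat.card_pos = 1 := PNat.eq Subgroup.card_bot
  unfold ell
  rw [h, map_one, Units.val_one]

variable {F G H : Type*} [Group F] [Group G] [Group H] [Finite G]

theorem sigma_ne_zero (U : Subgroup (F × G)) (V : Subgroup (G × H)) : sigma ℓ U V ≠ 0 :=
  ell_ne_zero _ _

theorem sigma_eq_one_of_left (U : Subgroup (F × G)) (V : Subgroup (G × H)) (h : rightKer U = ⊥) :
    sigma ℓ U V = 1 := by
  rw [sigma, ← ell_bot ℓ (A := G)]
  exact ell_congr ℓ (by rw [h, bot_inf_eq])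

theorem sigma_eq_one_of_right (U : Subgroup (F × G)) (V : Subgroup (G × H)) (h : leftKer V = ⊥) :
    sigma ℓ U V = 1 := by
  rw [sigma, ← ell_bot ℓ (A := G)]
  exact ell_congr ℓ (by rw [h, inf_bot_eq])

/-- Both kernels at the middle group are the copy of `Y` in `G`. The factor `ℓ(Y)⁻¹` in `μ_φ`
compensates for this scalar. -/
theorem sigma_defl_inf (B : Subgroup G) (Y : Subgroup B) [Y.Normal] (φ : B ⧸ Y ≃* F) :
    sigma ℓ (defl B Y φ) (inf B Y φ) = ell ℓ Y := by
  refine ell_congr ℓ ?_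
  rw [rightKer_defl, leftKer_inf, inf_idem]
  exact (Nat.card_congr (Y.equivMapOfInjective B.subtype B.subtype_injective).toEquiv).symm

end Cocycle

/-! ### Simple modules of locally unital rings -/

namespace LUModule

variable {A : Type*} [NonUnitalRing A]

theorem act_mul (M : LUModule.{k} A) (a b : A) (m : M.carrier) :
    M.act (a * b) m = M.act a (M.act b m) := by
  rw [map_mul]
  rfl

theorem act_add (M : LUModule.{k} A) (a b : A) (m : M.carrier) :
    M.act (a + b) m = M.act a m + M.act b m := by
  rw [map_add]
  rfl

theorem act_sub (M : LUModule.{k} A) (a b : A) (m : M.carrier) :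
    M.act (a - b) m = M.act a m - M.act b m := by
  rw [map_sub]
  rfl

theorem act_zero (M : LUModule.{k} A) (m : M.carrier) : M.act 0 m = 0 := by
  rw [map_zero]
  rfl

/-- The submodule `A x` of a module. -/
def cyclic (M : LUModule.{k} A) (x : M.carrier) : AddSubgroup M.carrier :=
  ((AddMonoidHom.eval x).comp (M.act : A →+ AddMonoid.End M.carrier)).range

theorem mem_cyclic {M : LUModule.{k} A} {x y : M.carrier} :
    y ∈ M.cyclic x ↔ ∃ a, M.act a x = y := Iff.rfl

theorem IsSimple.exists_act_eq {M : LUModule.{k} A} (hM : M.IsSimple) {x : M.carrier} (hx : x ≠ 0)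
    (y : M.carrier) : ∃ a, M.act a x = y := by
  have h := hM.2 (M.cyclic x) (by
    rintro a _ ⟨b, rfl⟩
    exact ⟨a * b, M.act_mul a b x⟩)
  rcases h with h | h
  · obtain ⟨e, -, he⟩ := M.exists_idem x
    have : x ∈ M.cyclic x := ⟨e, he⟩
    rw [h, AddSubgroup.mem_bot] at this
    exact absurd this hx
  · exact mem_cyclic.1 (h ▸ AddSubgroup.mem_top y)

/-- A homomorphism from a simple module is determined by where it sends a nonzero element, and exists
whenever annihilators allow it. -/
theorem IsSimple.exists_hom {M : LUModule.{k} A} (hM : M.IsSimple) {x : M.carrier} (hx : x ≠ 0)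
    {T : Type*} [AddCommGroup T] (ρ : A →ₙ+* AddMonoid.End T) {y : T}
    (hy : ∃ a, ρ a y ≠ 0) (hann : ∀ a, M.act a x = 0 → ρ a y = 0) :
    ∃ j : M.carrier →+ T, Function.Injective j ∧ (∀ a m, j (M.act a m) = ρ a (j m)) ∧
      ∀ a, j (M.act a x) = ρ a y := by
  have hwd : ∀ a b, M.act a x = M.act b x → ρ a y = ρ b y := by
    intro a b h
    have h1 := hann (a - b) (by rw [M.act_sub, h, sub_self])
    rw [map_sub] at h1
    exact sub_eq_zero.1 h1
  choose c hc using hM.exists_act_eq hx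
  let j : M.carrier →+ T := AddMonoidHom.mk' (fun m => ρ (c m) y) (by
    intro m n
    rw [hwd (c (m + n)) (c m + c n) (by rw [M.act_add, hc, hc, hc]), map_add]
    rfl)
  have hj : ∀ a, j (M.act a x) = ρ a y := fun a => hwd _ _ (hc _)
  have hjact : ∀ a m, j (M.act a m) = ρ a (j m) := by
    intro a m
    obtain ⟨b, rfl⟩ := hM.exists_act_eq hx m
    rw [← M.act_mul, hj, hj, map_mul]
    rfl
  refine ⟨j, ?_, hjact, hj⟩
  rcases hM.2 j.ker (fun a n hn => by
    rw [AddMonoidHom.mem_ker] at hn ⊢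
    rw [hjact, hn, map_zero]) with h | h
  · exact (AddMonoidHom.ker_eq_bot_iff j).1 h
  · obtain ⟨a, ha⟩ := hy
    refine absurd ?_ ha
    rw [← hj]
    exact AddMonoidHom.mem_ker.1 (h ▸ AddSubgroup.mem_top _)

theorem exists_act_ne_zero {M : LUModule.{k} A} {x : M.carrier} (hx : x ≠ 0) :
    ∃ a, M.act a x ≠ 0 := by
  obtain ⟨e, -, he⟩ := M.exists_idem x
  exact ⟨e, he.symm ▸ hx⟩

/-- An inclusion of annihilators in one direction suffices: the induced map is injective since the
source is simple, and surjective since `y` generates the target. -/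
theorem IsSimple.iso_of_ann {M N : LUModule.{k} A} (hM : M.IsSimple) (hN : N.IsSimple)
    {x : M.carrier} (hx : x ≠ 0) {y : N.carrier} (hy : y ≠ 0)
    (hann : ∀ a, M.act a x = 0 → N.act a y = 0) : M.Iso N := by
  obtain ⟨j, hinj, hact, hj⟩ := hM.exists_hom hx N.act (exists_act_ne_zero hy) hann
  refine ⟨AddEquiv.ofBijective j ⟨hinj, fun z => ?_⟩, hact⟩
  obtain ⟨a, rfl⟩ := hN.exists_act_eq hy z
  exact ⟨_, hj a⟩

end LUModule

namespace Lam

variable {𝕂 : Type k} [Field 𝕂] {ℓ : ℕ+ →* 𝕂ˣ} {K K' : Set FiniteGrp.{u}}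

theorem s_mul_idm {F G : K} (U : Subgroup (F.1 × G.1)) : s ℓ U * idm ℓ G = s ℓ U := by
  rw [idm, s_mul_s, sigma_eq_one_of_right _ _ _ (leftKer_graph _), one_smul, star_graph_refl]

theorem s_mul_idm_of_ne {F G G' : K} (h : G' ≠ G) (U : Subgroup (F.1 × G.1)) :
    s ℓ U * idm ℓ G' = 0 := s_mul_s_of_ne h _ _

theorem idm_mul_idm (G : K) : idm ℓ G * idm ℓ G = idm ℓ G := idm_mul_s _

/-- An element of `K` as an element of `K' ⊇ K`. -/
abbrev up (h : K ⊆ K') (G : K) : K' := ⟨G.1, h G.2⟩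

theorem incl_s (h : K ⊆ K') {F G : K} (U : Subgroup (F.1 × G.1)) :
    incl ℓ h (s ℓ U) = s ℓ (F := up h F) (G := up h G) U := inclLin_s h U

theorem incl_smul (h : K ⊆ K') (c : 𝕂) (a : Lam ℓ K) : incl ℓ h (c • a) = c • incl ℓ h a :=
  map_smul (inclLin ℓ h) c a

theorem incl_idm (h : K ⊆ K') (G : K) : incl ℓ h (idm ℓ G) = idm ℓ (up h G) := incl_s h _

theorem incl_comp {K'' : Set FiniteGrp.{u}} (h : K ⊆ K') (h' : K' ⊆ K'') (a : Lam ℓ K) :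
    incl ℓ h' (incl ℓ h a) = incl ℓ (h.trans h') a := by
  induction a using induction_s with
  | h0 => simp only [map_zero]
  | hadd x y hx hy => simp only [map_add, hx, hy]
  | hs c F G U => simp only [incl_smul, incl_s]

/-! ### Compression of a larger algebra to a smaller one -/

section Proj

/-- The projection to `Λ_K` from `Λ_{K'}` which kills the morphisms not between elements of `K`. -/
def proj (ℓ : ℕ+ →* 𝕂ˣ) (h : K ⊆ K') : Lam ℓ K' →ₗ[𝕂] Lam ℓ K :=
  (basis ℓ K').constr 𝕂 fun U =>
    if hU : U.cod.1 ∈ K ∧ U.dom.1 ∈ K then basis ℓ K ⟨⟨_, hU.1⟩, ⟨_, hU.2⟩, U.sub⟩ else 0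

theorem proj_s (h : K ⊆ K') {F G : K} (U : Subgroup (F.1 × G.1)) :
    proj ℓ h (s ℓ (F := up h F) (G := up h G) U) = s ℓ U := by
  rw [proj, s, Module.Basis.constr_basis, dif_pos ⟨F.2, G.2⟩]
  rfl

theorem proj_s_of_cod (h : K ⊆ K') {F G : K'} (U : Subgroup (F.1 × G.1)) (hF : F.1 ∉ K) :
    proj ℓ h (s ℓ U) = 0 := by
  rw [proj, s, Module.Basis.constr_basis, dif_neg fun h => hF h.1]

theorem proj_s_of_dom (h : K ⊆ K') {F G : K'} (U : Subgroup (F.1 × G.1)) (hG : G.1 ∉ K) :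
    proj ℓ h (s ℓ U) = 0 := by
  rw [proj, s, Module.Basis.constr_basis, dif_neg fun h => hG h.2]

theorem proj_incl (h : K ⊆ K') (a : Lam ℓ K) : proj ℓ h (incl ℓ h a) = a := by
  induction a using induction_s with
  | h0 => simp only [map_zero]
  | hadd x y hx hy => simp only [map_add, hx, hy]
  | hs c F G U => rw [incl_smul, incl_s, map_smul, proj_s]

theorem proj_incl_mul_s (h : K ⊆ K') {F G : K} (V : Subgroup (F.1 × G.1)) {G' H : K'}
    (U : Subgroup (G'.1 × H.1)) :
    proj ℓ h (s ℓ (F := up h F) (G := up h G) V * s ℓ U) = s ℓ V * proj ℓ h (s ℓ U) := by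
  by_cases hG : G' = up h G
  · subst hG
    rw [s_mul_s, map_smul]
    by_cases hH : H.1 ∈ K
    · obtain ⟨H, rfl⟩ : ∃ H' : K, H = up h H' := ⟨⟨H.1, hH⟩, rfl⟩
      rw [proj_s h (G := H), proj_s h (G := H), s_mul_s]
    · rw [proj_s_of_dom h _ hH, proj_s_of_dom h _ hH, smul_zero, mul_zero]
  · rw [s_mul_s_of_ne hG, map_zero]
    by_cases hH : G'.1 ∈ K ∧ H.1 ∈ K
    · obtain ⟨H, rfl⟩ : ∃ H' : K, H = up h H' := ⟨⟨H.1, hH.2⟩, rfl⟩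
      obtain ⟨G', rfl⟩ : ∃ H' : K, G' = up h H' := ⟨⟨G'.1, hH.1⟩, rfl⟩
      rw [proj_s, s_mul_s_of_ne]
      rintro rfl
      exact hG rfl
    · by_cases h1 : G'.1 ∈ K
      · rw [proj_s_of_dom h _ fun h2 => hH ⟨h1, h2⟩, mul_zero]
      · rw [proj_s_of_cod h _ h1, mul_zero]

theorem proj_s_mul_incl (h : K ⊆ K') {F G : K} (V : Subgroup (F.1 × G.1)) {H F' : K'}
    (U : Subgroup (H.1 × F'.1)) :
    proj ℓ h (s ℓ U * s ℓ (F := up h F) (G := up h G) V) = proj ℓ h (s ℓ U) * s ℓ V := by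
  by_cases hG : F' = up h F
  · subst hG
    rw [s_mul_s, map_smul]
    by_cases hH : H.1 ∈ K
    · obtain ⟨H, rfl⟩ : ∃ H' : K, H = up h H' := ⟨⟨H.1, hH⟩, rfl⟩
      rw [proj_s h (F := H), proj_s h (F := H), s_mul_s]
    · rw [proj_s_of_cod h _ hH, proj_s_of_cod h _ hH, smul_zero, zero_mul]
  · rw [s_mul_s_of_ne (Ne.symm hG), map_zero]
    by_cases hH : F'.1 ∈ K ∧ H.1 ∈ K
    · obtain ⟨H, rfl⟩ : ∃ H' : K, H = up h H' := ⟨⟨H.1, hH.2⟩, rfl⟩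
      obtain ⟨F', rfl⟩ : ∃ H' : K, F' = up h H' := ⟨⟨F'.1, hH.1⟩, rfl⟩
      rw [proj_s, s_mul_s_of_ne]
      rintro rfl
      exact hG rfl
    · by_cases h1 : F'.1 ∈ K
      · rw [proj_s_of_cod h _ fun h2 => hH ⟨h1, h2⟩, zero_mul]
      · rw [proj_s_of_dom h _ h1, zero_mul]

/-- Composing with a morphism over `K` leaves the far end of the other morphism unchanged, and
composability forces the near end into `K`. Together with `proj_mul_incl`, this makes the projection
a map of `Λ_K`-bimodules, though it is not multiplicative. -/
theorem proj_incl_mul (h : K ⊆ K') (d : Lam ℓ K) (a : Lam ℓ K') :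
    proj ℓ h (incl ℓ h d * a) = d * proj ℓ h a := by
  induction d using induction_s with
  | h0 => simp only [map_zero, zero_mul]
  | hadd x y hx hy => simp only [map_add, add_mul, hx, hy]
  | hs c F G V =>
    induction a using induction_s with
    | h0 => simp only [map_zero, mul_zero]
    | hadd x y hx hy => simp only [map_add, mul_add, hx, hy]
    | hs c' F' G' U =>
      simp only [incl_smul, incl_s, smul_mul_assoc, mul_smul_comm, map_smul, proj_incl_mul_s]

theorem proj_mul_incl (h : K ⊆ K') (d : Lam ℓ K) (a : Lam ℓ K') :
    proj ℓ h (a * incl ℓ h d) = proj ℓ h a * d := by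
  induction d using induction_s with
  | h0 => simp only [map_zero, mul_zero]
  | hadd x y hx hy => simp only [map_add, mul_add, hx, hy]
  | hs c F G V =>
    induction a using induction_s with
    | h0 => simp only [map_zero, zero_mul]
    | hadd x y hx hy => simp only [map_add, add_mul, hx, hy]
    | hs c' F' G' U =>
      simp only [incl_smul, incl_s, smul_mul_assoc, mul_smul_comm, map_smul, proj_s_mul_incl]

/-- The subcategory on `K` is full: sandwiching between identities of objects of `K` returns to
`Λ_K`. -/
theorem idm_mul_mul_idm (h : K ⊆ K') (F G : K) (a : Lam ℓ K') :
    idm ℓ (up h F) * a * idm ℓ (up h G) = incl ℓ h (idm ℓ F * proj ℓ h a * idm ℓ G) := by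
  induction a using induction_s with
  | h0 => simp only [map_zero, mul_zero, zero_mul]
  | hadd x y hx hy => simp only [map_add, mul_add, add_mul, hx, hy]
  | hs c F' G' U =>
    simp only [map_smul, mul_smul_comm, smul_mul_assoc, incl_smul]
    congr 1
    rw [← proj_incl_mul h, ← proj_mul_incl h, incl_idm, incl_idm]
    by_cases hF : F' = up h F
    · subst hF
      rw [idm_mul_s]
      by_cases hG : G' = up h G
      · subst hG
        rw [s_mul_idm, proj_s, incl_s]
      · rw [s_mul_idm_of_ne (Ne.symm hG), map_zero, map_zero]
    · rw [idm_mul_s_of_ne hF, zero_mul, map_zero, map_zero]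

end Proj

/-! ### The embedding of `𝕂 Aut(E)` and its retraction -/

section Mu

variable (ℓ) (G : K)

theorem mu_single (θ : MulAut G.1) (c : 𝕂) :
    mu ℓ G (MonoidAlgebra.single θ c) = c • s ℓ (graph θ) := by
  rw [mu, MonoidAlgebra.coeff_single, Finsupp.sum_single_index]
  exact zero_smul _ _

theorem mu_zero : mu ℓ G 0 = 0 := Finsupp.sum_zero_index

theorem mu_add (x y : MonoidAlgebra 𝕂 (MulAut G.1)) : mu ℓ G (x + y) = mu ℓ G x + mu ℓ G y := by
  rw [mu, MonoidAlgebra.coeff_add]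
  exact Finsupp.sum_add_index' (fun _ => zero_smul _ _) fun _ _ _ => add_smul _ _ _

theorem mu_mul (x y : MonoidAlgebra 𝕂 (MulAut G.1)) : mu ℓ G (x * y) = mu ℓ G x * mu ℓ G y := by
  induction x using MonoidAlgebra.induction_linear with
  | zero => simp only [zero_mul, mu_zero]
  | add a b ha hb => simp only [add_mul, mu_add, ha, hb]
  | single θ c =>
    induction y using MonoidAlgebra.induction_linear with
    | zero => simp only [mul_zero, mu_zero]
    | add a b ha hb => simp only [mul_add, mu_add, ha, hb]
    | single η d =>
      rw [MonoidAlgebra.single_mul_single, mu_single, mu_single, mu_single, smul_mul_assoc,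
        mul_smul_comm, s_mul_s, sigma_eq_one_of_left _ _ _ (rightKer_graph _), one_smul, smul_smul,
        star_graph_graph]
      rfl

theorem mu_one : mu ℓ G 1 = idm ℓ G := by
  rw [MonoidAlgebra.one_def, mu_single, one_smul]
  rfl

theorem idm_mul_mu (x : MonoidAlgebra 𝕂 (MulAut G.1)) : idm ℓ G * mu ℓ G x = mu ℓ G x := by
  rw [← mu_one, ← mu_mul, one_mul]

theorem incl_mu (h : K ⊆ K') (x : MonoidAlgebra 𝕂 (MulAut G.1)) :
    incl ℓ h (mu ℓ G x) = mu ℓ (up h G) x := by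
  induction x using MonoidAlgebra.induction_linear with
  | zero => simp only [mu_zero, map_zero]
  | add a b ha hb => rw [mu_add, mu_add (G := up h G), map_add, ha, hb]
  | single θ c => rw [mu_single, mu_single (G := up h G), incl_smul, incl_s]

/-- The retraction of `μ_E` that kills the morphisms other than the automorphisms of `E`. -/
def retr (E : K) : Lam ℓ K →ₗ[𝕂] MonoidAlgebra 𝕂 (MulAut E.1) :=
  (basis ℓ K).constr 𝕂 fun U =>
    if h : ∃ θ : MulAut E.1, U = ⟨E, E, graph θ⟩ then MonoidAlgebra.single h.choose 1 else 0

variable (E : K)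

theorem retr_graph (θ : MulAut E.1) :
    retr ℓ E (s ℓ (graph θ)) = MonoidAlgebra.single θ 1 := by
  have h : ∃ η : MulAut E.1, (⟨E, E, graph θ⟩ : Mor K) = ⟨E, E, graph η⟩ := ⟨θ, rfl⟩
  have h1 : graph h.choose = graph θ := (eq_of_heq (Mor.mk.inj h.choose_spec).2.2).symm
  rw [retr, s, Module.Basis.constr_basis, dif_pos h, graph_injective h1]

theorem retr_of_ne (U : Subgroup (E.1 × E.1)) (hU : ∀ θ : E.1 ≃* E.1, U ≠ graph θ) :
    retr ℓ E (s ℓ U) = 0 := by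
  rw [retr, s, Module.Basis.constr_basis, dif_neg]
  rintro ⟨θ, h⟩
  simp only [Mor.mk.injEq, heq_eq_eq, true_and] at h
  exact hU θ h

theorem retr_s_mul_s (U V : Subgroup (E.1 × E.1)) :
    retr ℓ E (s ℓ U * s ℓ V) = retr ℓ E (s ℓ U) * retr ℓ E (s ℓ V) := by
  rw [s_mul_s, map_smul]
  by_cases hU : ∃ θ : E.1 ≃* E.1, U = graph θ
  · by_cases hV : ∃ θ : E.1 ≃* E.1, V = graph θ
    · obtain ⟨θ, rfl⟩ := hU
      obtain ⟨η, rfl⟩ := hV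
      rw [star_graph_graph, retr_graph ℓ E, retr_graph ℓ E, retr_graph ℓ E,
        sigma_eq_one_of_left _ _ _ (rightKer_graph _), one_smul, MonoidAlgebra.single_mul_single,
        one_mul]
      rfl
    · rw [retr_of_ne ℓ E V fun θ h => hV ⟨θ, h⟩, mul_zero, retr_of_ne, smul_zero]
      exact fun θ h => hV (graph_right_of_star_eq_graph h)
  · rw [retr_of_ne ℓ E U fun θ h => hU ⟨θ, h⟩, zero_mul, retr_of_ne, smul_zero]
    exact fun θ h => hU (graph_left_of_star_eq_graph h)

/-- With a single object, the basis elements that are not graphs span a two-sided ideal. With more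
objects this can fail, as an automorphism of `E` may factor through a larger group. -/
theorem retr_mul [Subsingleton K] (a b : Lam ℓ K) :
    retr ℓ E (a * b) = retr ℓ E a * retr ℓ E b := by
  induction a using induction_s with
  | h0 => simp only [map_zero, zero_mul]
  | hadd x y hx hy => simp only [map_add, add_mul, hx, hy]
  | hs c F G V =>
    obtain rfl := Subsingleton.elim F E
    obtain rfl := Subsingleton.elim G F
    induction b using induction_s with
    | h0 => simp only [map_zero, mul_zero]
    | hadd x y hx hy => simp only [map_add, mul_add, hx, hy]
    | hs c' F' G' U =>
      obtain rfl := Subsingleton.elim F' G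
      obtain rfl := Subsingleton.elim G' F'
      simp only [smul_mul_assoc, mul_smul_comm, map_smul, retr_s_mul_s]

theorem retr_mu (x : MonoidAlgebra 𝕂 (MulAut E.1)) : retr ℓ E (mu ℓ E x) = x := by
  induction x using MonoidAlgebra.induction_linear with
  | zero => simp only [mu_zero, map_zero]
  | add a b ha hb => rw [mu_add, map_add, ha, hb]
  | single θ c => rw [mu_single, map_smul, retr_graph, MonoidAlgebra.smul_single, smul_eq_mul, mul_one]

end Mu

/-! ### The maps `μ_φ` -/

section MuPhi

variable (ℓ) {E : FiniteGrp.{u}} (G : K) (B : Subgroup G.1) (Y : Subgroup B) [Y.Normal]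
  (φ : B ⧸ Y ≃* E)

theorem muPhi_single (ε : MulAut E) (c : 𝕂) :
    muPhi ℓ G B Y φ (MonoidAlgebra.single ε c) =
      c • (ell ℓ Y)⁻¹ • s ℓ (F := G) (G := G) (goursat B Y B Y ((φ.trans ε).trans φ.symm)) := by
  rw [muPhi, MonoidAlgebra.coeff_single, Finsupp.sum_single_index]
  exact zero_smul _ _

theorem muPhi_zero : muPhi ℓ G B Y φ 0 = 0 := Finsupp.sum_zero_index

theorem muPhi_add (x y : MonoidAlgebra 𝕂 (MulAut E)) :
    muPhi ℓ G B Y φ (x + y) = muPhi ℓ G B Y φ x + muPhi ℓ G B Y φ y := by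
  rw [muPhi, MonoidAlgebra.coeff_add]
  exact Finsupp.sum_add_index' (fun _ => zero_smul _ _) fun _ _ _ => add_smul _ _ _

theorem incl_muPhi (h : K ⊆ K') (x : MonoidAlgebra 𝕂 (MulAut E)) :
    incl ℓ h (muPhi ℓ G B Y φ x) = muPhi ℓ (up h G) B Y φ x := by
  induction x using MonoidAlgebra.induction_linear with
  | zero => rw [muPhi_zero, muPhi_zero ℓ (up h G), map_zero]
  | add a b ha hb => rw [muPhi_add, muPhi_add ℓ (up h G), map_add, ha, hb]
  | single θ c => rw [muPhi_single, muPhi_single ℓ (up h G), incl_smul, incl_smul, incl_s]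

theorem muPhi_trans {E' : FiniteGrp.{u}} (θ : E ≃* E') (x : MonoidAlgebra 𝕂 (MulAut E)) :
    muPhi ℓ G B Y (φ.trans θ) (Seed.autIso 𝕂 θ x) = muPhi ℓ G B Y φ x := by
  induction x using MonoidAlgebra.induction_linear with
  | zero => rw [map_zero, muPhi_zero, muPhi_zero]
  | add a b ha hb => rw [map_add, muPhi_add, muPhi_add, ha, hb]
  | single ε c =>
    have h : ((φ.trans θ).trans (MulAut.congr θ ε)).trans (φ.trans θ).symm =
        (φ.trans ε).trans φ.symm := by
      ext x
      simp [MulAut.congr]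
    rw [Seed.autIso, MonoidAlgebra.domCongr_single, muPhi_single, muPhi_single, h]

end MuPhi

/-- Inflation has trivial right kernel and deflation trivial left kernel, so no cocycle factor
appears in the triple product. -/
theorem muPhi_eq {E G : K} (B : Subgroup G.1) (Y : Subgroup B) [Y.Normal] (φ : B ⧸ Y ≃* E.1)
    (x : MonoidAlgebra 𝕂 (MulAut E.1)) :
    muPhi ℓ G B Y φ x =
      (ell ℓ Y)⁻¹ • (s ℓ (F := G) (inf B Y φ) * mu ℓ E x * s ℓ (G := G) (defl B Y φ)) := by
  induction x using MonoidAlgebra.induction_linear with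
  | zero => rw [muPhi_zero, mu_zero, mul_zero, zero_mul, smul_zero]
  | add a b ha hb => rw [muPhi_add, mu_add, mul_add, add_mul, smul_add, ha, hb]
  | single ε c =>
    rw [muPhi_single, mu_single, mul_smul_comm, smul_mul_assoc, s_mul_s,
      sigma_eq_one_of_left _ _ _ (rightKer_inf B Y φ), one_smul, s_mul_s,
      sigma_eq_one_of_right _ _ _ (leftKer_defl B Y φ), one_smul, inf_star_graph_star_defl,
      smul_comm]

theorem s_defl_mul_s_inf {E G : K} (B : Subgroup G.1) (Y : Subgroup B) [Y.Normal]
    (φ : B ⧸ Y ≃* E.1) :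
    s ℓ (G := G) (defl B Y φ) * s ℓ (F := G) (inf B Y φ) = ell ℓ Y • idm ℓ E := by
  rw [s_mul_s, defl_star_inf, sigma_defl_inf]
  rfl

end Lam

variable {𝕂 : Type k} [Field 𝕂] {ℓ : ℕ+ →* 𝕂ˣ} {K K' : Set FiniteGrp.{u}}

namespace Lam

theorem retr_of_cod {E F G : K} (h : F ≠ E) (U : Subgroup (F.1 × G.1)) :
    retr ℓ E (s ℓ U) = 0 := by
  rw [retr, s, Module.Basis.constr_basis, dif_neg]
  rintro ⟨θ, hθ⟩
  exact h (Mor.mk.inj hθ).1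

theorem retr_of_dom {E F G : K} (h : G ≠ E) (U : Subgroup (F.1 × G.1)) :
    retr ℓ E (s ℓ U) = 0 := by
  rw [retr, s, Module.Basis.constr_basis, dif_neg]
  rintro ⟨θ, hθ⟩
  exact h (Mor.mk.inj hθ).2.1

theorem mu_autIso_mul {E E' : K} (θ : E'.1 ≃* E.1) (x : MonoidAlgebra 𝕂 (MulAut E'.1)) :
    mu ℓ E (Seed.autIso 𝕂 θ x) * s ℓ (graph θ) = s ℓ (graph θ) * mu ℓ E' x := by
  induction x using MonoidAlgebra.induction_linear with
  | zero => rw [map_zero, mu_zero, mu_zero, zero_mul, mul_zero]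
  | add a b ha hb => rw [map_add, mu_add, mu_add, add_mul, mul_add, ha, hb]
  | single ε c =>
    have h : θ.trans (MulAut.congr θ ε) = MulEquiv.trans ε θ := by
      ext x
      simp [MulAut.congr]
    rw [Seed.autIso, MonoidAlgebra.domCongr_single, mu_single, mu_single, smul_mul_assoc,
      mul_smul_comm, s_mul_s, s_mul_s, sigma_eq_one_of_left _ _ _ (rightKer_graph _),
      sigma_eq_one_of_left _ _ _ (rightKer_graph _), one_smul, one_smul, star_graph_graph,
      star_graph_graph, h]

end Lam

open Lam

/-! ### Evaluations of modules and minimal groups -/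

namespace LamModule

/-- The modules are only abelian groups, so scalars must come from `Λ`: with a local unit `e` for
`a`, one has `c • a = (c • e) * a`. -/
theorem act_smul_of_act {M : LamModule ℓ K} (c : 𝕂) {a : Lam ℓ K} {z : M.carrier}
    (h : M.act a z = 0) : M.act (c • a) z = 0 := by
  obtain ⟨T, hT⟩ := exists_idSum_mul a
  rw [← hT, ← smul_mul_assoc, M.act_mul, h, map_zero]

theorem act_smul_eq_zero {M : LamModule ℓ K} {c : 𝕂} (hc : c ≠ 0) {a : Lam ℓ K} {z : M.carrier}
    (h : M.act (c • a) z = 0) : M.act a z = 0 := by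
  have := act_smul_of_act c⁻¹ h
  rwa [smul_smul, inv_mul_cancel₀ hc, one_smul] at this

theorem mem_eval {M : LamModule ℓ K} {G : K} {z : M.carrier} :
    z ∈ M.eval G ↔ M.act (idm ℓ G) z = z := by
  constructor
  · rintro ⟨y, rfl⟩
    exact (M.act_mul _ _ y).symm.trans (congrArg (fun a => M.act a y) (idm_mul_idm G))
  · exact fun h => ⟨z, h⟩

theorem act_idm_mem_eval (M : LamModule ℓ K) (G : K) (z : M.carrier) :
    M.act (idm ℓ G) z ∈ M.eval G := ⟨z, rfl⟩

theorem act_s_mem_eval (M : LamModule ℓ K) {F G : K} (U : Subgroup (F.1 × G.1)) (z : M.carrier) :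
    M.act (s ℓ U) z ∈ M.eval F := by
  rw [mem_eval, ← M.act_mul, idm_mul_s]

theorem act_mu_mem_eval (M : LamModule ℓ K) {E : K} (x : MonoidAlgebra 𝕂 (MulAut E.1))
    (z : M.carrier) : M.act (mu ℓ E x) z ∈ M.eval E := by
  rw [mem_eval, ← M.act_mul, idm_mul_mu]

theorem eval_ne_bot {M : LamModule ℓ K} {G : K} {z : M.carrier} (hz : z ∈ M.eval G) (h : z ≠ 0) :
    M.eval G ≠ ⊥ := by
  intro hb
  rw [hb, AddSubgroup.mem_bot] at hz
  exact h hz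

theorem exists_ne_zero {M : LamModule ℓ K} {G : K} (h : M.eval G ≠ ⊥) : ∃ z ∈ M.eval G, z ≠ 0 := by
  obtain ⟨z, hz, h0⟩ := AddSubgroup.bot_or_exists_ne_zero (M.eval G) |>.resolve_left h
  exact ⟨z, hz, h0⟩

theorem exists_sum_eq (M : LamModule ℓ K) (z : M.carrier) :
    ∃ T : Finset K, ∑ G ∈ T, M.act (idm ℓ G) z = z := by
  obtain ⟨e, -, he⟩ := M.exists_idem z
  obtain ⟨T, hT⟩ := exists_idSum_mul e
  refine ⟨T, ?_⟩
  have h1 : M.act (idSum ℓ T) z = z := by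
    rw [← he, ← M.act_mul, hT]
  rw [idSum, map_sum] at h1
  exact (AddMonoidHom.finsetSum_apply _ _ z).symm.trans h1

theorem exists_idm_act_ne_zero (M : LamModule ℓ K) {z : M.carrier} (hz : z ≠ 0) :
    ∃ G : K, M.act (idm ℓ G) z ≠ 0 := by
  by_contra! h
  obtain ⟨T, hT⟩ := M.exists_sum_eq z
  exact hz (hT ▸ Finset.sum_eq_zero fun G _ => h G)

/-- The identity of `F` removes the terms of `a` with another codomain, and `z = id_E z` those with
another domain. -/
theorem act_idm_act_mem_closure (M : LamModule ℓ K) {E F : K} {z : M.carrier} (hz : z ∈ M.eval E)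
    (a : Lam ℓ K) : M.act (idm ℓ F) (M.act a z) ∈ AddSubgroup.closure
      {y | ∃ (c : 𝕂) (V : Subgroup (F.1 × E.1)), M.act (c • s ℓ V) z = y} := by
  induction a using induction_s with
  | h0 =>
    rw [M.act_zero, map_zero]
    exact zero_mem _
  | hadd x y hx hy =>
    rw [M.act_add, map_add]
    exact add_mem hx hy
  | hs c F' G U =>
    by_cases hG : E = G
    · subst hG
      by_cases hF : F' = F
      · subst hF
        rw [← M.act_mul, mul_smul_comm, idm_mul_s]
        exact AddSubgroup.subset_closure ⟨c, U, rfl⟩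
      · rw [← M.act_mul, mul_smul_comm, idm_mul_s_of_ne hF, smul_zero, M.act_zero]
        exact zero_mem _
    · rw [← mem_eval.1 hz, ← M.act_mul (c • _), smul_mul_assoc, s_mul_idm_of_ne hG, smul_zero,
        M.act_zero, map_zero]
      exact zero_mem _

/-- The morphisms to `E` from `E` other than the automorphisms act on `M(E)` as zero. -/
def Pure (M : LamModule ℓ K) (E : K) : Prop :=
  ∀ U : Subgroup (E.1 × E.1), (∀ θ : E.1 ≃* E.1, U ≠ graph θ) → ∀ z ∈ M.eval E, M.act (s ℓ U) z = 0

/-- A non-automorphism `U` factors through the section of `E` that it determines. Were the module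
nonzero there, minimality would make the section all of `E` by order, and `U` would be a graph. -/
theorem pure_of_minimal (hK : ClosedUnderFactorGroups K) (M : LamModule ℓ K) (E : K)
    (hmin : ∀ F : K, M.eval F ≠ ⊥ → IsFactorGroup F.1 E.1 → IsFactorGroup E.1 F.1) :
    M.Pure E := by
  intro U hU z hz
  obtain ⟨B, Y, hY, hB, hYU, hfac⟩ := exists_factorization.{u} U
  obtain ⟨F, hF, ⟨φ⟩⟩ := hK E.1 E.2 B Y
  let F' : K := ⟨F, hF⟩
  have hbot : M.eval F' = ⊥ := by
    by_contra hne
    have hc := (hmin F' hne ⟨B, Y, hY, ⟨φ⟩⟩).card_le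
    rw [← Nat.card_congr φ.toEquiv] at hc
    obtain ⟨hB', hY'⟩ := subquotient_card_eq hc
    obtain ⟨θ, hθ⟩ := exists_eq_graph' U (fun s => (hB s).1 (hB' ▸ Subgroup.mem_top s))
      (fun s hs => by
        have h1 : (⟨s, hB' ▸ Subgroup.mem_top s⟩ : B) ∈ Y := (hYU _).2 hs
        rw [hY', Subgroup.mem_bot] at h1
        exact congrArg Subtype.val h1)
    exact hU θ hθ
  have h0 : M.act (s ℓ (F := F') (defl B Y φ)) z = 0 := by
    have := M.act_s_mem_eval (ℓ := ℓ) (F := F') (defl B Y φ) z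
    rwa [hbot, AddSubgroup.mem_bot] at this
  refine act_smul_eq_zero (sigma_ne_zero ℓ (star U (inf B Y φ)) (defl B Y φ)) ?_
  have h1 := s_mul_s (ℓ := ℓ) (F := E) (G := F') (H := E) (star U (inf B Y φ)) (defl B Y φ)
  rw [hfac] at h1
  rw [← h1, M.act_mul, h0, map_zero]

/-- The least group at which a simple module does not vanish. -/
theorem Pure.isFactorGroup {M : LamModule ℓ K} {E F : K} (hp : M.Pure E) (hM : M.IsSimple)
    (hE : M.eval E ≠ ⊥) (hF : M.eval F ≠ ⊥) : IsFactorGroup E.1 F.1 := by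
  obtain ⟨z, hz, hz0⟩ := exists_ne_zero hE
  obtain ⟨y, hy, hy0⟩ := exists_ne_zero hF
  obtain ⟨a, ha⟩ := hM.exists_act_eq hz0 y
  obtain ⟨b, hb⟩ := hM.exists_act_eq hy0 z
  by_contra hn
  -- Simplicity moves `z` to `y` and back. If `E` were not a factor group of `F`, every composite
  -- from `E` through `F` to `E` would be a non-automorphism, so the round trip would give zero.
  have key : ∀ y' ∈ AddSubgroup.closure
      {y | ∃ (c : 𝕂) (V : Subgroup (F.1 × E.1)), M.act (c • s ℓ V) z = y},
      M.act (idm ℓ E) (M.act b y') = 0 := by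
    intro y' hy'
    induction hy' using AddSubgroup.closure_induction with
    | mem y hy =>
      obtain ⟨c, V, rfl⟩ := hy
      have hm : M.act (c • s ℓ V) z ∈ M.eval F := by
        rw [mem_eval, ← M.act_mul, mul_smul_comm, idm_mul_s]
      have h1 := M.act_idm_act_mem_closure (F := E) hm b
      rw [← AddSubgroup.mem_bot]
      refine (AddSubgroup.closure_le _).2 ?_ h1
      rintro _ ⟨d, U, rfl⟩
      change _ = _
      rw [← M.act_mul, smul_mul_assoc, mul_smul_comm, s_mul_s, smul_smul, smul_smul]
      exact act_smul_of_act _ (hp _ (fun θ h => hn (isFactorGroup_of_star_eq_graph h)) z hz)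
    | zero => rw [map_zero, map_zero]
    | add _ _ _ _ h1 h2 => rw [map_add, map_add, h1, h2, add_zero]
    | neg _ _ h1 => rw [map_neg, map_neg, h1, neg_zero]
  refine hz0 ?_
  rw [← mem_eval.1 hz, ← hb]
  refine key y ?_
  rw [← mem_eval.1 hy, ← ha]
  exact M.act_idm_act_mem_closure hz a

theorem act_smul_idm_ne_zero {M : LamModule ℓ K} {E : K} {c : 𝕂} (hc : c ≠ 0) {z : M.carrier}
    (hz : z ∈ M.eval E) (hz0 : z ≠ 0) : M.act (c • idm ℓ E) z ≠ 0 := by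
  intro h
  have := act_smul_eq_zero hc h
  rw [mem_eval.1 hz] at this
  exact hz0 this

/-- Inflation from `E` to `F` is injective on `M(E)`, because deflation after it is the nonzero
scalar `ℓ(Y)`. -/
theorem eval_ne_bot_of_isFactorGroup {M : LamModule ℓ K} {E F : K} (hE : M.eval E ≠ ⊥)
    (h : IsFactorGroup E.1 F.1) : M.eval F ≠ ⊥ := by
  obtain ⟨z, hz, hz0⟩ := exists_ne_zero hE
  obtain ⟨B, Y, _, ⟨φ⟩⟩ := h
  refine eval_ne_bot (M.act_s_mem_eval (F := F) (inf B Y φ) z) fun h0 => ?_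
  refine act_smul_idm_ne_zero (ell_ne_zero ℓ Y) hz hz0 ?_
  rw [← s_defl_mul_s_inf (G := F) B Y φ, M.act_mul, h0, map_zero]

/-- The retraction is not multiplicative in general, but on `M(E)` it computes the `E`-component of
the action of all of `Λ`. Thus that component depends only on the `𝕂 Aut(E)`-module structure. -/
theorem Pure.act_eq {M : LamModule ℓ K} {E : K} (hp : M.Pure E) {z : M.carrier}
    (hz : z ∈ M.eval E) (a : Lam ℓ K) :
    M.act (idm ℓ E) (M.act a z) = M.act (mu ℓ E (retr ℓ E a)) z := by
  induction a using induction_s with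
  | h0 => rw [map_zero (retr ℓ E), mu_zero, M.act_zero, map_zero]
  | hadd x y hx hy => rw [map_add (retr ℓ E), mu_add, M.act_add, M.act_add, map_add, hx, hy]
  | hs c F G U =>
    rw [← M.act_mul, mul_smul_comm, map_smul (retr ℓ E)]
    by_cases hG : E = G
    · subst hG
      by_cases hF : F = E
      · subst hF
        rw [idm_mul_s]
        by_cases hU : ∃ θ : F.1 ≃* F.1, U = graph θ
        · obtain ⟨θ, rfl⟩ := hU
          rw [retr_graph, MonoidAlgebra.smul_single, mu_single, smul_eq_mul, mul_one]
        · rw [retr_of_ne _ _ _ fun θ h => hU ⟨θ, h⟩, smul_zero, mu_zero, M.act_zero]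
          exact act_smul_of_act c (hp U (fun θ h => hU ⟨θ, h⟩) z hz)
      · rw [idm_mul_s_of_ne hF, retr_of_cod hF, smul_zero, smul_zero, mu_zero]
    · rw [retr_of_dom (Ne.symm hG), smul_zero, mu_zero, M.act_zero, ← mem_eval.1 hz, ← M.act_mul,
        smul_mul_assoc, mul_assoc, s_mul_idm_of_ne hG, mul_zero, smul_zero, M.act_zero]

end LamModule

/-! ### Corners and the extension of simple modules -/

namespace LamModule

/-- `j` identifies the `Λ_K`-module `S` with the submodule `Λ_K T` of the `Λ_{K'}`-module `T`. -/
structure IsCornerEmb (h : K ⊆ K') (S : LamModule ℓ K) (T : LamModule ℓ K')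
    (j : S.carrier →+ T.carrier) : Prop where
  injective : Function.Injective j
  map_act : ∀ a m, j (S.act a m) = T.act (incl ℓ h a) (j m)
  eval_le : ∀ G : K, T.eval (up h G) ≤ j.range

namespace IsCornerEmb

variable {h : K ⊆ K'} {S : LamModule ℓ K} {T : LamModule ℓ K'} {j : S.carrier →+ T.carrier}

theorem map_mem_eval (hj : IsCornerEmb h S T j) {G : K} {z : S.carrier} (hz : z ∈ S.eval G) :
    j z ∈ T.eval (up h G) := by
  rw [mem_eval, ← incl_idm, ← hj.map_act, mem_eval.1 hz]

theorem exists_mem_eval (hj : IsCornerEmb h S T j) {G : K} {t : T.carrier}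
    (ht : t ∈ T.eval (up h G)) : ∃ z ∈ S.eval G, j z = t := by
  obtain ⟨z, rfl⟩ := hj.eval_le G ht
  refine ⟨z, mem_eval.2 (hj.injective ?_), rfl⟩
  rw [hj.map_act, incl_idm, mem_eval.1 ht]

theorem map_eq_zero (hj : IsCornerEmb h S T j) {z : S.carrier} : j z = 0 ↔ z = 0 :=
  map_eq_zero_iff j hj.injective

theorem exists_act_ne_zero_iff (hj : IsCornerEmb h S T j) (G : K) (a : Lam ℓ K) :
    (∃ m ∈ S.eval G, S.act a m ≠ 0) ↔ ∃ m ∈ T.eval (up h G), T.act (incl ℓ h a) m ≠ 0 := by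
  constructor
  · rintro ⟨m, hm, h0⟩
    refine ⟨j m, hj.map_mem_eval hm, ?_⟩
    rwa [← hj.map_act, Ne, hj.map_eq_zero]
  · rintro ⟨t, ht, h0⟩
    obtain ⟨m, hm, rfl⟩ := hj.exists_mem_eval ht
    rw [← hj.map_act, Ne, hj.map_eq_zero] at h0
    exact ⟨m, hm, h0⟩

theorem eval_ne_bot_iff (hj : IsCornerEmb h S T j) (G : K) :
    S.eval G ≠ ⊥ ↔ T.eval (up h G) ≠ ⊥ := by
  constructor
  · intro hS
    obtain ⟨z, hz, h0⟩ := exists_ne_zero hS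
    exact eval_ne_bot (hj.map_mem_eval hz) (hj.map_eq_zero.not.2 h0)
  · intro hT
    obtain ⟨t, ht, h0⟩ := exists_ne_zero hT
    obtain ⟨z, hz, rfl⟩ := hj.exists_mem_eval ht
    exact eval_ne_bot hz (hj.map_eq_zero.not.1 h0)

theorem mem_range (hj : IsCornerEmb h S T j) (a : Lam ℓ K) (m : T.carrier) :
    T.act (incl ℓ h a) m ∈ j.range := by
  obtain ⟨A, hA⟩ := exists_idSum_mul a
  rw [← hA, map_mul, T.act_mul, idSum, map_sum, map_sum]
  have h1 := AddMonoidHom.finsetSum_apply (fun G => (T.act (incl ℓ h (idm ℓ G)) :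
    T.carrier →+ T.carrier)) A (T.act (incl ℓ h a) m)
  refine h1.symm ▸ sum_mem fun G _ => hj.eval_le G ?_
  rw [incl_idm]
  exact T.act_idm_mem_eval _ _

theorem isSimple (hj : IsCornerEmb h S T j) (hT : T.IsSimple) (hS : Nontrivial S.carrier) :
    S.IsSimple := by
  refine ⟨hS, fun N hN => or_iff_not_imp_left.2 fun hbot => ?_⟩
  obtain ⟨n, hn, hn0⟩ := (AddSubgroup.bot_or_exists_ne_zero N).resolve_left hbot
  obtain ⟨G, hG⟩ := S.exists_idm_act_ne_zero hn0
  rw [eq_top_iff]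
  intro m _
  obtain ⟨A, hA⟩ := S.exists_sum_eq m
  rw [← hA]
  refine sum_mem fun F _ => ?_
  -- Simplicity of `T` supplies an element of the larger algebra; its compression between `id_F` and
  -- `id_G` lies in `Λ_K` and has the same effect.
  obtain ⟨b, hb⟩ := hT.exists_act_eq (hj.map_eq_zero.not.2 hG) (j m)
  have h1 : S.act (idm ℓ F) m = S.act (idm ℓ F * proj ℓ h b * idm ℓ G) n := by
    apply hj.injective
    rw [hj.map_act, hj.map_act, ← idm_mul_mul_idm, ← hb, hj.map_act, incl_idm, incl_idm,
      T.act_mul, T.act_mul]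
  rw [h1]
  exact hN _ _ hn

theorem trans {K'' : Set FiniteGrp.{u}} {h' : K' ⊆ K''} {P : LamModule ℓ K''}
    {i : T.carrier →+ P.carrier} (hj : IsCornerEmb h S T j) (hi : IsCornerEmb h' T P i) :
    IsCornerEmb (h.trans h') S P (i.comp j) where
  injective := hi.injective.comp hj.injective
  map_act a m := by
    change i (j _) = P.act _ (i (j m))
    rw [hj.map_act, hi.map_act, incl_comp]
  eval_le G p hp := by
    obtain ⟨t, ht, rfl⟩ := hi.exists_mem_eval (G := up h G) hp
    obtain ⟨z, hz, rfl⟩ := hj.exists_mem_eval ht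
    exact ⟨z, rfl⟩

theorem pure (hj : IsCornerEmb h S T j) {E : K} (hp : S.Pure E) : T.Pure (up h E) := by
  intro U hU t ht
  obtain ⟨z, hz, rfl⟩ := hj.exists_mem_eval ht
  have := hj.map_act (s ℓ (F := E) (G := E) U) z
  rw [hp U hU z hz, map_zero, incl_s] at this
  exact this.symm

theorem iso_left {S' : LamModule ℓ K} (hj : IsCornerEmb h S T j) (f : S'.carrier ≃+ S.carrier)
    (hf : ∀ a m, f (S'.act a m) = S.act a (f m)) :
    IsCornerEmb h S' T (j.comp f.toAddMonoidHom) where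
  injective := hj.injective.comp f.injective
  map_act a m := by
    change j (f _) = T.act _ (j (f m))
    rw [hf, hj.map_act]
  eval_le G t ht := by
    obtain ⟨z, rfl⟩ := hj.eval_le G ht
    exact ⟨f.symm z, congrArg j (f.apply_symm_apply z)⟩

end IsCornerEmb

theorem isCornerEmb_corner (h : K ⊆ K') (T : LamModule ℓ K') :
    IsCornerEmb h (corner h T) T (cornerSubgroup h T).subtype where
  injective := Subtype.val_injective
  map_act _ _ := rfl
  eval_le G := by
    rintro _ ⟨m, rfl⟩
    refine ⟨⟨_, act_mem_cornerSubgroup h T (idm ℓ G) m⟩, ?_⟩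
    exact congrArg (fun a => T.act a m) (incl_idm h G)

/-- Since `a` has a local unit that is a sum of identities on `K`, the subgroup `Λ_K T` is generated
by the `T(G)` with `G ∈ K`. An embedding containing these has exactly that range. -/
theorem iso_corner_iff (h : K ⊆ K') (S : LamModule ℓ K) (T : LamModule ℓ K') :
    S.Iso (corner h T) ↔ ∃ j, IsCornerEmb h S T j := by
  constructor
  · rintro ⟨f, hf⟩
    exact ⟨_, (isCornerEmb_corner h T).iso_left f hf⟩
  · rintro ⟨j, hj⟩
    have hr : j.range = cornerSubgroup h T := by
      apply le_antisymm
      · rintro _ ⟨z, rfl⟩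
        obtain ⟨e, -, he⟩ := S.exists_idem z
        rw [← he, hj.map_act]
        exact act_mem_cornerSubgroup h T e _
      · refine (AddSubgroup.closure_le _).2 ?_
        rintro _ ⟨a, m, rfl⟩
        exact hj.mem_range a m
    refine ⟨(AddMonoidHom.ofInjective hj.injective).trans (AddEquiv.addSubgroupCongr hr), ?_⟩
    intro a m
    exact Subtype.ext (hj.map_act a m)

/-- The quotient of `Λ` by a left ideal. -/
def quotientModule (N : AddSubgroup (Lam ℓ K)) (hN : ∀ a, ∀ n ∈ N, a * n ∈ N) : LamModule ℓ K where
  carrier := Lam ℓ K ⧸ N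
  act :=
    { toFun := fun a => QuotientAddGroup.map N N (AddMonoidHom.mulLeft a) (hN a)
      map_zero' := by
        ext ⟨x⟩
        exact congrArg (QuotientAddGroup.mk' N) (zero_mul x)
      map_add' := fun a b => by
        ext ⟨x⟩
        exact congrArg (QuotientAddGroup.mk' N) (add_mul a b x)
      map_mul' := fun a b => by
        ext ⟨x⟩
        exact congrArg (QuotientAddGroup.mk' N) (mul_assoc a b x) }
  exists_idem := by
    rintro ⟨x⟩
    obtain ⟨T, hT⟩ := exists_idSum_mul x
    exact ⟨idSum ℓ T, idSum_mul_idSum subset_rfl, congrArg (QuotientAddGroup.mk' N) hT⟩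

/-- Every simple `Λ_K`-module is `Λ_K T` for a simple `Λ_{K'}`-module `T`. -/
theorem exists_extension (h : K ⊆ K') (S : LamModule ℓ K) (hS : S.IsSimple) :
    ∃ T : LamModule ℓ K', T.IsSimple ∧ ∃ j, IsCornerEmb h S T j := by
  have := hS.1
  obtain ⟨x₀, hx₀⟩ := exists_ne (0 : S.carrier)
  obtain ⟨G, hG⟩ := S.exists_idm_act_ne_zero hx₀
  generalize hx : S.act (idm ℓ G) x₀ = x at hG
  have hxG : S.act (idm ℓ G) x = x := by
    rw [← hx, ← S.act_mul, idm_mul_idm]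
  -- `Ψ` is how `Λ_{K'}` should act on `x` once the result is cut down to `S`.
  let Ψ : Lam ℓ K' → S.carrier := fun b => S.act (proj ℓ h b) x
  have Ψ_add : ∀ a b, Ψ (a + b) = Ψ a + Ψ b := fun a b => by
    simp only [Ψ, map_add (proj ℓ h), S.act_add]
  have Ψ_incl_mul : ∀ d a, Ψ (incl ℓ h d * a) = S.act d (Ψ a) := fun d a => by
    simp only [Ψ, proj_incl_mul, S.act_mul]
  have Ψ_mul_incl : ∀ a d, Ψ (a * incl ℓ h d) = S.act (proj ℓ h a) (S.act d x) := fun a d => by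
    simp only [Ψ, proj_mul_incl, S.act_mul]
  have Ψ_mul_idm : ∀ a, Ψ (a * idm ℓ (up h G)) = Ψ a := fun a => by
    rw [← incl_idm, Ψ_mul_incl, hxG]
  -- This is the largest left ideal inside the kernel of `Ψ`: an element is discarded only if no
  -- multiple of it is visible in `S`.
  let N : AddSubgroup (Lam ℓ K') :=
    { carrier := {a | ∀ b, Ψ (b * a) = 0}
      zero_mem' := fun b => by rw [mul_zero]; simp only [Ψ, map_zero (proj ℓ h), S.act_zero]
      add_mem' := fun {a a'} ha ha' b => by rw [mul_add, Ψ_add, ha, ha', add_zero]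
      neg_mem' := fun {a} ha b => by
        have h1 := Ψ_add (b * a) (b * -a)
        rw [← mul_add, add_neg_cancel, mul_zero, ha, zero_add] at h1
        rw [← h1]
        simp only [Ψ, map_zero (proj ℓ h), S.act_zero] }
  have hN : ∀ a, ∀ n ∈ N, a * n ∈ N := fun a n hn b => by
    rw [← mul_assoc]
    exact hn _
  let T : LamModule ℓ K' := quotientModule N hN
  let q : Lam ℓ K' →+ T.carrier := QuotientAddGroup.mk' N
  have q_act : ∀ a b, T.act a (q b) = q (a * b) := fun a b => rfl
  have q_surj : Function.Surjective q := QuotientAddGroup.mk'_surjective N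
  have q_zero : ∀ a, q a = 0 ↔ ∀ b, Ψ (b * a) = 0 := fun a =>
    QuotientAddGroup.eq_zero_iff a
  have q_eq : ∀ a a', (∀ b, Ψ (b * a) = Ψ (b * a')) → q a = q a' := by
    intro a a' haa
    rw [← sub_eq_zero, ← map_sub, q_zero]
    intro b
    have h1 := Ψ_add (b * (a - a')) (b * a')
    rw [← mul_add, sub_add_cancel, haa] at h1
    exact right_eq_add.1 h1
  let y := q (idm ℓ (up h G))
  have q_eq_act : ∀ a, q a = T.act a y := fun a => by
    rw [q_act]
    refine q_eq _ _ fun b => ?_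
    rw [← mul_assoc, Ψ_mul_idm]
  have Ψ_idm : Ψ (idm ℓ (up h G)) = x := by
    simp only [Ψ]
    rw [← incl_idm, proj_incl, hxG]
  have hy : y ≠ 0 := by
    intro h0
    have := (q_zero _).1 h0 (idm ℓ (up h G))
    rw [idm_mul_idm, Ψ_idm] at this
    exact hG this
  have hTS : T.IsSimple := by
    refine ⟨⟨⟨y, 0, hy⟩⟩, fun P hP => or_iff_not_imp_left.2 fun hbot => ?_⟩
    obtain ⟨n, hn, hn0⟩ := (AddSubgroup.bot_or_exists_ne_zero P).resolve_left hbot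
    obtain ⟨a, rfl⟩ := q_surj n
    rw [Ne, q_zero] at hn0
    push Not at hn0
    obtain ⟨b, hb⟩ := hn0
    -- A nonzero class has a multiple visible in `S`; simplicity of `S` moves that to `x`, and `id_G
    -- d b` then carries the class to the generator `y`.
    obtain ⟨d, hd⟩ := hS.exists_act_eq hb x
    have hyP : T.act (idm ℓ (up h G) * incl ℓ h d * b) (q a) = y := by
      rw [q_act]
      refine q_eq _ _ fun b' => ?_
      have h1 : idm ℓ (up h G) * incl ℓ h d * b * a = idm ℓ (up h G) * (incl ℓ h d * b * a) := by
        simp only [mul_assoc]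
      have h2 : S.act (proj ℓ h (incl ℓ h d * b * a)) x = x := by
        rw [mul_assoc]
        exact (Ψ_incl_mul d (b * a)).trans hd
      rw [h1, ← Ψ_mul_idm, mul_assoc, idm_mul_mul_idm h, Ψ_mul_incl, S.act_mul, hxG, S.act_mul,
        h2, hxG, Ψ_mul_idm]
    rw [eq_top_iff]
    intro t _
    obtain ⟨c, rfl⟩ := q_surj t
    rw [q_eq_act, ← hyP]
    exact hP _ _ (hP _ _ hn)
  obtain ⟨j, hj1, hj2, hj3⟩ := hS.exists_hom hG (T.act.comp (incl ℓ h)) (y := y)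
    ⟨idm ℓ G, by
      change T.act (incl ℓ h (idm ℓ G)) y ≠ 0
      rw [incl_idm, q_act, idm_mul_idm]
      exact hy⟩
    (fun a ha => by
      change T.act (incl ℓ h a) y = 0
      rw [← q_eq_act, q_zero]
      intro b
      rw [Ψ_mul_incl, ha, map_zero])
  refine ⟨T, hTS, j, hj1, hj2, fun F t ht => ?_⟩
  obtain ⟨c, rfl⟩ := q_surj t
  refine ⟨S.act (idm ℓ F * proj ℓ h c * idm ℓ G) x, ?_⟩
  rw [hj3]
  change T.act (incl ℓ h _) y = _
  rw [← idm_mul_mul_idm, T.act_mul, T.act_mul, q_act _ (idm ℓ _), idm_mul_idm, ← q_eq_act,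
    mem_eval.1 ht]

end LamModule

/-! ### Idempotents and simple modules of semisimple rings -/

section Rings

variable {R R' : Type*} [Ring R] [Ring R']

theorem isSimpleModule_compHom (σ : R ≃+* R') (N : Type*) [AddCommGroup N] [Module R' N]
    [IsSimpleModule R' N] :
    letI := Module.compHom N σ.toRingHom
    IsSimpleModule R N := by
  let _ := Module.compHom N σ.toRingHom
  refine isSimpleModule_iff_toSpanSingleton_surjective.2
    ⟨IsSimpleModule.nontrivial R' N, fun x hx y => ?_⟩
  obtain ⟨r, rfl⟩ := IsSimpleModule.toSpanSingleton_surjective R' hx y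
  refine ⟨σ.symm r, ?_⟩
  change σ (σ.symm r) • x = r • x
  rw [σ.apply_symm_apply]

/-- A simple module of a semisimple ring is determined by the idempotents that do not annihilate
it. -/
theorem exists_equiv_of_idempotents [IsSemisimpleRing R] (σ : R ≃+* R') (M N : Type*)
    [AddCommGroup M] [Module R M] [IsSimpleModule R M] [AddCommGroup N] [Module R' N]
    [IsSimpleModule R' N]
    (h : ∀ e : R, IsIdempotentElem e → (∃ m : M, e • m ≠ 0) → ∃ n : N, σ e • n ≠ 0) :
    ∃ f : M ≃+ N, ∀ (r : R) m, f (r • m) = σ r • f m := by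
  let _ := Module.compHom N σ.toRingHom
  have := isSimpleModule_compHom σ N
  have hM := IsSimpleModule.nontrivial R M
  obtain ⟨m, hm⟩ := exists_ne (0 : M)
  have := Module.projective_of_isSemisimpleRing R M
  -- `M` is projective, so `r ↦ r m` splits. The image `t m` is an idempotent fixing `m`, and the
  -- hypothesis then gives an `n` with `σ (t m) • n ≠ 0`.
  obtain ⟨t, ht⟩ := Module.projective_lifting_property (LinearMap.toSpanSingleton R M m)
    LinearMap.id (IsSimpleModule.toSpanSingleton_surjective R hm)
  have htm : t m • m = m := LinearMap.congr_fun ht m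
  obtain ⟨n, hn⟩ := h (t m) (by
    rw [IsIdempotentElem, ← smul_eq_mul, ← map_smul, htm]) ⟨m, by rwa [htm]⟩
  -- This map sends `m` to `σ (t m) • n ≠ 0`, so Schur's lemma applies.
  let g : M →ₗ[R] N := (LinearMap.toSpanSingleton R N n).comp t
  have hg : g ≠ 0 := fun h0 => hn (LinearMap.congr_fun h0 m)
  let f := LinearEquiv.ofBijective g (LinearMap.bijective_of_ne_zero hg)
  exact ⟨f.toAddEquiv, fun r m => f.map_smul r m⟩

end Rings

/-! ### Inflation to a one-object algebra, and transport along corners -/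

namespace LamModule

section Inflate

variable (ℓ) [Subsingleton K] (E : K) (W : Type k) [AddCommGroup W]
  [Module (MonoidAlgebra 𝕂 (MulAut E.1)) W]

/-- When `E` is the only element of `K`, the inflation of a `𝕂 Aut(E)`-module to `Λ`. -/
def inflate : LamModule ℓ K where
  carrier := ULift.{u + 1} W
  act :=
    { toFun := fun a =>
        Module.toAddMonoidEnd (MonoidAlgebra 𝕂 (MulAut E.1)) (ULift.{u + 1} W) (retr ℓ E a)
      map_zero' := by rw [map_zero, map_zero]
      map_add' := fun a b => by rw [map_add, map_add]
      map_mul' := fun a b => by rw [retr_mul, map_mul] }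
  exists_idem m := by
    refine ⟨idm ℓ E, idm_mul_idm E, ?_⟩
    change retr ℓ E (idm ℓ E) • m = m
    rw [← mu_one, retr_mu, one_smul]

theorem inflate_act (a : Lam ℓ K) (w : W) :
    (inflate ℓ E W).act a (ULift.up w) = ULift.up (retr ℓ E a • w) := rfl

theorem inflate_isSimple [IsSimpleModule (MonoidAlgebra 𝕂 (MulAut E.1)) W] :
    (inflate ℓ E W).IsSimple := by
  have := IsSimpleModule.nontrivial (MonoidAlgebra 𝕂 (MulAut E.1)) W
  refine ⟨inferInstanceAs (Nontrivial (ULift W)), fun N hN => or_iff_not_imp_left.2 fun hb => ?_⟩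
  obtain ⟨⟨n⟩, hn, hn0⟩ := (AddSubgroup.bot_or_exists_ne_zero N).resolve_left hb
  rw [eq_top_iff]
  rintro ⟨w⟩ -
  have hn0' : n ≠ 0 := fun h => hn0 (congrArg ULift.up h)
  obtain ⟨x, rfl⟩ := IsSimpleModule.toSpanSingleton_surjective
    (MonoidAlgebra 𝕂 (MulAut E.1)) hn0' w
  have := hN (mu ℓ E x) _ hn
  rwa [inflate_act, retr_mu] at this

theorem inflate_pure : (inflate ℓ E W).Pure E := by
  rintro U hU ⟨w⟩ -
  rw [inflate_act, retr_of_ne _ _ _ hU, zero_smul]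
  rfl

theorem inflate_eval : (inflate ℓ E W).eval E = ⊤ := by
  rw [eq_top_iff]
  rintro ⟨w⟩ -
  refine mem_eval.2 ?_
  rw [inflate_act, ← mu_one, retr_mu, one_smul]

end Inflate

/-- The identification of `S(G)` with `T(G)` for `S = Λ_K T` and `G ∈ K`. -/
def IsCornerEmb.evalEquiv {h : K ⊆ K'} {S : LamModule ℓ K} {T : LamModule ℓ K'}
    {j : S.carrier →+ T.carrier} (hj : IsCornerEmb h S T j) (G : K) :
    S.eval G ≃+ T.eval (up h G) :=
  AddEquiv.ofBijective
    ((j.comp (S.eval G).subtype).codRestrict (T.eval (up h G)) fun z => hj.map_mem_eval z.2)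
    ⟨fun _ _ h => Subtype.ext (hj.injective (congrArg Subtype.val h)), fun t => by
      obtain ⟨z, hz, h⟩ := hj.exists_mem_eval t.2
      exact ⟨⟨z, hz⟩, Subtype.ext h⟩⟩

theorem IsCornerEmb.iso_right {h : K ⊆ K'} {S : LamModule ℓ K} {T T' : LamModule ℓ K'}
    {j : S.carrier →+ T.carrier} (hj : IsCornerEmb h S T j) (f : T.carrier ≃+ T'.carrier)
    (hf : ∀ a m, f (T.act a m) = T'.act a (f m)) :
    IsCornerEmb h S T' (f.toAddMonoidHom.comp j) where
  injective := f.injective.comp hj.injective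
  map_act a m := by
    change f (j _) = T'.act _ (f (j m))
    rw [hj.map_act, hf]
  eval_le G t ht := by
    have h1 : f.symm t ∈ T.eval (up h G) := by
      rw [mem_eval] at ht ⊢
      apply f.injective
      rw [hf, f.apply_symm_apply, ht]
    obtain ⟨z, hz⟩ := hj.eval_le G h1
    exact ⟨z, (congrArg f hz).trans (f.apply_symm_apply t)⟩

end LamModule

open LamModule

theorem closedUnderFactorGroups_univ : ClosedUnderFactorGroups (Set.univ : Set FiniteGrp.{u}) :=
  fun _ _ B Y _ => ⟨FiniteGrp.of (B ⧸ Y), trivial, ⟨MulEquiv.refl _⟩⟩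

/-! ### Simple modules with a prescribed minimal seed -/

namespace Seed

theorem nontrivial (p : Seed 𝕂 K) : Nontrivial p.W :=
  IsSimpleModule.nontrivial (MonoidAlgebra 𝕂 (MulAut p.E)) p.W

theorem minimalIn_of_pure {p : Seed 𝕂 K} {hE : p.E ∈ K} {M : LamModule ℓ K} (hM : M.IsSimple)
    (hp : M.Pure ⟨p.E, hE⟩) (f : p.W ≃+ M.eval ⟨p.E, hE⟩)
    (hf : ∀ x w, (f (x • w) : M.carrier) = M.act (Lam.mu ℓ ⟨p.E, hE⟩ x) (f w)) :
    p.MinimalIn hE M := by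
  have hne : M.eval ⟨p.E, hE⟩ ≠ ⊥ := by
    have := p.nontrivial
    obtain ⟨w, hw⟩ := exists_ne (0 : p.W)
    refine eval_ne_bot (f w).2 fun h => hw ?_
    exact (map_eq_zero_iff f f.injective).1 (Subtype.ext h)
  exact ⟨hne, fun F hF _ => hp.isFactorGroup hM hne hF, f, hf⟩

theorem MinimalIn.pure (hK : ClosedUnderFactorGroups K) {p : Seed 𝕂 K} {hE : p.E ∈ K}
    {M : LamModule ℓ K} (h : p.MinimalIn hE M) : M.Pure ⟨p.E, hE⟩ :=
  pure_of_minimal hK M _ h.2.1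

/-- Purity is a separate hypothesis because `K` need not be closed under factor groups. It survives
extension, since it concerns only endomorphisms of `E`, and it yields minimality over `K'`. -/
theorem MinimalIn.of_isCornerEmb {p : Seed 𝕂 K} {hE : p.E ∈ K} {S : LamModule ℓ K}
    (hp : S.Pure ⟨p.E, hE⟩) (hmin : p.MinimalIn hE S) {h : K ⊆ K'} {T : LamModule ℓ K'}
    (hT : T.IsSimple) {j : S.carrier →+ T.carrier} (hj : IsCornerEmb h S T j) :
    (p.mono h).MinimalIn (h hE) T := by
  obtain ⟨-, -, f, hf⟩ := hmin
  refine minimalIn_of_pure hT (hj.pure hp) (f.trans (hj.evalEquiv ⟨p.E, hE⟩)) fun x w => ?_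
  exact (congrArg j (hf x w)).trans ((hj.map_act _ _).trans
    (congrArg (fun a => T.act a (j (f w))) (incl_mu ℓ ⟨p.E, hE⟩ h x)))

/-- Over `{E}` alone, `W` becomes a simple module by letting non-automorphisms act as zero;
extending it to `K` preserves purity. -/
theorem exists_minimalIn (ℓ : ℕ+ →* 𝕂ˣ) (p : Seed 𝕂 K) (hE : p.E ∈ K) :
    ∃ T : LamModule ℓ K, T.IsSimple ∧ p.MinimalIn hE T := by
  let p₀ : Seed 𝕂 {p.E} :=
    { E := p.E
      isFactor := ⟨p.E, rfl, IsFactorGroup.of_mulEquiv (MulEquiv.refl _)⟩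
      W := p.W }
  let E₀ : ({p.E} : Set FiniteGrp.{u}) := ⟨p.E, rfl⟩
  let S : LamModule ℓ {p.E} := inflate ℓ E₀ p.W
  have hS : S.IsSimple := inflate_isSimple ℓ E₀ p.W
  have hpure : S.Pure E₀ := inflate_pure ℓ E₀ p.W
  let f : p.W ≃+ S.eval E₀ :=
    (AddEquiv.ulift.symm.trans AddSubgroup.topEquiv.symm).trans
      (AddEquiv.addSubgroupCongr (inflate_eval ℓ E₀ p.W).symm)
  have hmin : p₀.MinimalIn rfl S := by
    refine minimalIn_of_pure hS hpure f fun x w => ?_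
    change ULift.up (x • w) = S.act (mu ℓ E₀ x) (ULift.up w)
    rw [inflate_act, retr_mu]
  obtain ⟨T, hT, j, hj⟩ := exists_extension (Set.singleton_subset_iff.2 hE) S hS
  exact ⟨T, hT, hmin.of_isCornerEmb hpure hT hj⟩

theorem MinimalIn.iso (hK : ClosedUnderFactorGroups K) {p : Seed 𝕂 K} {hE : p.E ∈ K}
    {S T : LamModule ℓ K} (hS : S.IsSimple) (hT : T.IsSimple) (hpS : p.MinimalIn hE S)
    (hpT : p.MinimalIn hE T) : S.Iso T := by
  have hS' := hpS.pure hK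
  have hT' := hpT.pure hK
  obtain ⟨-, -, f, hf⟩ := hpS
  obtain ⟨-, -, g, hg⟩ := hpT
  have := p.nontrivial
  obtain ⟨w, hw⟩ := exists_ne (0 : p.W)
  have hfw : (f w : S.carrier) ≠ 0 := fun h =>
    hw ((map_eq_zero_iff f f.injective).1 (Subtype.ext h))
  have hgw : (g w : T.carrier) ≠ 0 := fun h =>
    hw ((map_eq_zero_iff g g.injective).1 (Subtype.ext h))
  refine hS.iso_of_ann hT hfw hgw fun a ha => ?_
  -- Suppose `a` kills `f w` but not `g w`. Bring `a (g w)` back to `g w` by `b`; then `id_E b a`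
  -- acts through one element of `𝕂 Aut(E)` on both evaluations, which would have to kill `w` and
  -- fix it.
  by_contra hne
  obtain ⟨b, hb⟩ := hT.exists_act_eq hne (g w)
  have h1 : S.act (idm ℓ ⟨p.E, hE⟩) (S.act (b * a) (f w)) = 0 := by
    rw [S.act_mul, ha, map_zero, map_zero]
  have h2 : T.act (idm ℓ ⟨p.E, hE⟩) (T.act (b * a) (g w)) = g w := by
    rw [T.act_mul, hb, mem_eval.1 (g w).2]
  rw [hS'.act_eq (f w).2, ← hf] at h1
  rw [hT'.act_eq (g w).2, ← hg] at h2
  have h3 := (map_eq_zero_iff f f.injective).1 (Subtype.ext h1)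
  rw [h3, map_zero] at h2
  exact hgw h2.symm

theorem MinimalIn.of_equivalent (hK : ClosedUnderFactorGroups K) {p q : Seed 𝕂 K}
    (hpq : p.Equivalent q) {hp : p.E ∈ K} {hq : q.E ∈ K} {M : LamModule ℓ K} (hM : M.IsSimple)
    (h : q.MinimalIn hq M) : p.MinimalIn hp M := by
  have hpure := h.pure hK
  obtain ⟨hne, -, g, hg⟩ := h
  obtain ⟨θ, f, hf⟩ := hpq
  let P : K := ⟨p.E, hp⟩
  let Q : K := ⟨q.E, hq⟩
  have inv : ∀ (A B : K) (η : B.1 ≃* A.1) (z : M.carrier), z ∈ M.eval A →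
      M.act (s ℓ (F := A) (G := B) (graph η)) (M.act (s ℓ (F := B) (G := A) (graph η.symm)) z) =
        z := by
    intro A B η z hz
    have h1 : η.symm.trans η = MulEquiv.refl A.1 := by
      ext x
      simp
    rw [← M.act_mul, s_mul_s, sigma_eq_one_of_left _ _ _ (rightKer_graph _), one_smul,
      star_graph_graph, h1]
    exact mem_eval.1 hz
  let e : M.eval Q ≃+ M.eval P :=
    { toFun := fun z => ⟨M.act (s ℓ (F := P) (G := Q) (graph θ)) z, M.act_s_mem_eval _ _⟩
      invFun := fun z => ⟨M.act (s ℓ (F := Q) (G := P) (graph θ.symm)) z, M.act_s_mem_eval _ _⟩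
      left_inv := fun z => Subtype.ext (inv Q P θ.symm z z.2)
      right_inv := fun z => Subtype.ext (inv P Q θ z z.2)
      map_add' := fun y z => Subtype.ext (map_add _ _ _) }
  let f' : p.W ≃+ M.eval P := (f.symm.trans g).trans e
  have hf' : ∀ x w, (f' (x • w) : M.carrier) = M.act (mu ℓ P x) (f' w) := by
    intro x w
    obtain ⟨y, rfl⟩ := (autIso 𝕂 θ).surjective x
    obtain ⟨v, rfl⟩ := f.surjective w
    change M.act _ (g (f.symm _)) = M.act _ (M.act _ (g (f.symm _)))
    rw [← hf, f.symm_apply_apply, f.symm_apply_apply, hg, ← M.act_mul, ← M.act_mul,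
      mu_autIso_mul (E := P) (E' := Q)]
  have hPne : M.eval P ≠ ⊥ := by
    have := p.nontrivial
    obtain ⟨w, hw⟩ := exists_ne (0 : p.W)
    refine eval_ne_bot (f' w).2 fun h => hw ?_
    exact (map_eq_zero_iff f' f'.injective).1 (Subtype.ext h)
  exact ⟨hPne, fun F hF _ => (hpure.isFactorGroup hM hne hF).congr_left θ, f', hf'⟩

/-- If `x` kills `W`, it kills every deflated element. If `x • w ≠ 0`, the inflation of `w` is a
witness: deflating the outcome gives a nonzero multiple of `x • w`. -/
theorem MinimalIn.exists_act_muPhi_ne_zero_iff {p : Seed 𝕂 K} {hE : p.E ∈ K} {M : LamModule ℓ K}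
    (h : p.MinimalIn hE M) (G : K) (B : Subgroup G.1) (Y : Subgroup B) [Y.Normal]
    (φ : B ⧸ Y ≃* p.E) (x : MonoidAlgebra 𝕂 (MulAut p.E)) :
    (∃ m ∈ M.eval G, M.act (muPhi ℓ G B Y φ x) m ≠ 0) ↔ ∃ w : p.W, x • w ≠ 0 := by
  obtain ⟨-, -, f, hf⟩ := h
  let E : K := ⟨p.E, hE⟩
  have hmu : muPhi ℓ G B Y φ x = (ell ℓ Y)⁻¹ •
      (s ℓ (F := G) (G := E) (inf B Y φ) * mu ℓ E x * s ℓ (F := E) (G := G) (defl B Y φ)) :=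
    muPhi_eq (E := E) B Y φ x
  have hid : s ℓ (F := E) (G := G) (defl B Y φ) * s ℓ (F := G) (G := E) (inf B Y φ) =
      ell ℓ Y • idm ℓ E := s_defl_mul_s_inf (E := E) B Y φ
  rw [hmu]
  constructor
  · rintro ⟨m, -, h0⟩
    by_contra! hx
    refine h0 (act_smul_of_act _ ?_)
    obtain ⟨w, hw⟩ := f.surjective ⟨_, M.act_s_mem_eval (ℓ := ℓ) (F := E) (defl B Y φ) m⟩
    have hw' : (f w : M.carrier) = M.act (s ℓ (F := E) (G := G) (defl B Y φ)) m :=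
      congrArg Subtype.val hw
    rw [M.act_mul, M.act_mul, ← hw', ← hf, hx, map_zero, ZeroMemClass.coe_zero, map_zero]
  · rintro ⟨w, hw⟩
    refine ⟨M.act (s ℓ (F := G) (G := E) (inf B Y φ)) (f w), M.act_s_mem_eval _ _, fun h0 => ?_⟩
    have h1 := act_smul_eq_zero (inv_ne_zero (ell_ne_zero ℓ Y)) h0
    rw [← M.act_mul, mul_assoc, hid, mul_smul_comm] at h1
    have h2 := act_smul_eq_zero (ell_ne_zero ℓ Y) h1
    rw [mul_assoc, M.act_mul, M.act_mul, mem_eval.1 (f w).2, ← hf] at h2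
    have hne : (f (x • w) : M.carrier) ≠ 0 := fun h =>
      hw ((map_eq_zero_iff f f.injective).1 (Subtype.ext h))
    refine act_smul_idm_ne_zero (ell_ne_zero ℓ Y) (f (x • w)).2 hne ?_
    rw [← hid, M.act_mul, h2, map_zero]

/-- A module on which some `μ_φ(x)` is nonzero, where `φ` is an isomorphism to `E`, does not vanish
at `E`. -/
theorem eval_ne_bot_of_act_muPhi {E G : K} {M : LamModule ℓ K} {B : Subgroup G.1} {Y : Subgroup B}
    [Y.Normal] {φ : B ⧸ Y ≃* E.1} {x : MonoidAlgebra 𝕂 (MulAut E.1)} {m : M.carrier}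
    (h : M.act (muPhi ℓ G B Y φ x) m ≠ 0) : M.eval E ≠ ⊥ := by
  refine eval_ne_bot (M.act_s_mem_eval (ℓ := ℓ) (F := E) (defl B Y φ) m) fun h0 => h ?_
  rw [muPhi_eq]
  refine act_smul_of_act _ ?_
  rw [M.act_mul, h0, map_zero]

/-- The transport of a seed along an isomorphism. -/
def transport (p : Seed 𝕂 K) (E : FiniteGrp.{u}) (θ : E ≃* p.E) : Seed 𝕂 K :=
  letI := Module.compHom p.W (autIso 𝕂 θ).toRingEquiv.toRingHom
  { E := E
    isFactor := by
      obtain ⟨G, hG, h⟩ := p.isFactor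
      exact ⟨G, hG, h.congr_left θ.symm⟩
    W := p.W
    simple := isSimpleModule_compHom (autIso 𝕂 θ).toRingEquiv p.W }

theorem equivalent_transport (p : Seed 𝕂 K) (E : FiniteGrp.{u}) (θ : E ≃* p.E) :
    p.Equivalent (p.transport E θ) := ⟨θ, AddEquiv.refl _, fun _ _ => rfl⟩

end Seed

/-! ### `M(E)` as a simple `𝕂 Aut(E)`-module -/

namespace LamModule

/-- The action of `𝕂 Aut(E)` on `M(E)`. -/
def evalHom (M : LamModule ℓ K) (E : K) :
    MonoidAlgebra 𝕂 (MulAut E.1) →+* AddMonoid.End (M.eval E) where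
  toFun x := ((M.act (mu ℓ E x)).comp (M.eval E).subtype).codRestrict (M.eval E)
    fun z => M.act_mu_mem_eval x z
  map_one' := by
    ext z
    change M.act (mu ℓ E 1) z = z
    rw [mu_one]
    exact mem_eval.1 z.2
  map_mul' x y := by
    ext z
    change M.act (mu ℓ E (x * y)) z = M.act (mu ℓ E x) (M.act (mu ℓ E y) z)
    rw [mu_mul, M.act_mul]
  map_zero' := by
    ext z
    change M.act (mu ℓ E 0) z = 0
    rw [mu_zero, M.act_zero]
  map_add' x y := by
    ext z
    change M.act (mu ℓ E (x + y)) z = M.act (mu ℓ E x) z + M.act (mu ℓ E y) z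
    rw [mu_add, M.act_add]

instance evalModule (M : LamModule ℓ K) (E : K) :
    Module (MonoidAlgebra 𝕂 (MulAut E.1)) (M.eval E) :=
  Module.compHom (M.eval E) (evalHom M E)

theorem Pure.isSimpleModule {M : LamModule ℓ K} {E : K} (hp : M.Pure E) (hM : M.IsSimple)
    (hE : M.eval E ≠ ⊥) : IsSimpleModule (MonoidAlgebra 𝕂 (MulAut E.1)) (M.eval E) := by
  refine isSimpleModule_iff_toSpanSingleton_surjective.2 ⟨?_, fun z hz y => ?_⟩
  · obtain ⟨z, hz, h0⟩ := exists_ne_zero hE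
    exact ⟨⟨z, hz⟩, 0, fun h => h0 (congrArg Subtype.val h)⟩
  · obtain ⟨a, ha⟩ := hM.exists_act_eq (fun h => hz (Subtype.ext h)) (y : M.carrier)
    refine ⟨retr ℓ E a, Subtype.ext ?_⟩
    change M.act (mu ℓ E (retr ℓ E a)) z = y
    rw [← hp.act_eq z.2, ha, mem_eval.1 y.2]

end LamModule

theorem small_monoidAlgebra (G : Type*) [Finite G] : Small.{k} (MonoidAlgebra 𝕂 G) := by
  have : Small.{k} (G → 𝕂) := inferInstance
  refine small_of_injective (β := G → 𝕂) (f := fun x => (x.coeff : G → 𝕂)) fun x y h => ?_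
  exact MonoidAlgebra.coeff_injective (DFunLike.coe_injective h)

/-- A seed has its module in the universe of `𝕂`, whereas `M(E)` lives higher; a simple module is a
quotient of the finite-dimensional group algebra, so it can be shrunk. -/
theorem small_of_isSimpleModule {G : Type*} [Group G] [Finite G] (W : Type*) [AddCommGroup W]
    [Module (MonoidAlgebra 𝕂 G) W] [IsSimpleModule (MonoidAlgebra 𝕂 G) W] : Small.{k} W := by
  have := IsSimpleModule.nontrivial (MonoidAlgebra 𝕂 G) W
  obtain ⟨w, hw⟩ := exists_ne (0 : W)
  have := small_monoidAlgebra (𝕂 := 𝕂) G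
  exact small_of_surjective (IsSimpleModule.toSpanSingleton_surjective (MonoidAlgebra 𝕂 G) hw)

/-! ### The correspondence and its characterization -/

namespace Seed

/-- `S ≅ S_{E, W}`, constructed using all finite groups. -/
def IsSeedModule (p : Seed 𝕂 K) (S : LamModule ℓ K) : Prop :=
  ∃ T : LamModule ℓ Set.univ, T.IsSimple ∧
    (p.mono (Set.subset_univ K)).MinimalIn (Set.mem_univ p.E) T ∧
    ∃ j, IsCornerEmb (Set.subset_univ K) S T j

theorem IsSeedModule.of_iso {p : Seed 𝕂 K} {S S' : LamModule ℓ K} (h : p.IsSeedModule S)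
    (hS : S'.Iso S) : p.IsSeedModule S' := by
  obtain ⟨T, hT, hmin, j, hj⟩ := h
  obtain ⟨f, hf⟩ := hS
  exact ⟨T, hT, hmin, _, hj.iso_left f hf⟩

theorem IsSeedModule.of_equivalent {p q : Seed 𝕂 K} {S : LamModule ℓ K} (h : q.IsSeedModule S)
    (hpq : p.Equivalent q) : p.IsSeedModule S := by
  obtain ⟨T, hT, hmin, hj⟩ := h
  exact ⟨T, hT, hmin.of_equivalent closedUnderFactorGroups_univ
    (p := p.mono (Set.subset_univ K)) (q := q.mono (Set.subset_univ K)) hpq hT, hj⟩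

theorem IsSeedModule.iso {p : Seed 𝕂 K} {S S' : LamModule ℓ K} (h : p.IsSeedModule S)
    (h' : p.IsSeedModule S') : S.Iso S' := by
  obtain ⟨T, hT, hmin, hj⟩ := h
  obtain ⟨T', hT', hmin', j', hj'⟩ := h'
  obtain ⟨f, hf⟩ := hmin'.iso closedUnderFactorGroups_univ hT' hT hmin
  exact LUModule.Iso.equivalence.trans ((iso_corner_iff _ _ _).2 hj)
    (LUModule.Iso.equivalence.symm ((iso_corner_iff _ _ _).2 ⟨_, hj'.iso_right f hf⟩))

/-- Extending `S'` further to all finite groups keeps its seed and its corner over `K`, which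
removes the dependence on `K'`. -/
theorem IsSeedModule.of_via {h : K ⊆ K'} (hK' : ClosedUnderFactorGroups K') {p : Seed 𝕂 K}
    {S : LamModule ℓ K} (hS : p.IsSeedModuleVia h S) : p.IsSeedModule S := by
  obtain ⟨⟨S', hS'⟩, ⟨q, hE, hpq, hmin⟩, hiso⟩ := hS
  obtain ⟨j, hj⟩ := (iso_corner_iff _ _ _).1 hiso
  obtain ⟨T, hT, i, hi⟩ := exists_extension (Set.subset_univ K') S' hS'
  exact ⟨T, hT, (hmin.of_isCornerEmb (hmin.pure hK') hT hi).of_equivalent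
    closedUnderFactorGroups_univ (p := p.mono (Set.subset_univ K))
      (q := q.mono (Set.subset_univ K')) hpq hT, _, hj.trans hi⟩

theorem exists_corresponds (ℓ : ℕ+ →* 𝕂ˣ) (h : K ⊆ K') (hK' : ClosedUnderFactorGroups K')
    (p : Seed 𝕂 K) : ∃ S' : SimpleLamModule ℓ K', (p.mono h).Corresponds S'.1 := by
  obtain ⟨G, hG, B, Y, _, ⟨φ⟩⟩ := p.isFactor
  obtain ⟨E, hE, ⟨ψ⟩⟩ := hK' G (h hG) B Y
  let q := (p.mono h).transport E (ψ.symm.trans φ)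
  obtain ⟨T, hT, hmin⟩ := exists_minimalIn ℓ q hE
  exact ⟨⟨T, hT⟩, q, hE, equivalent_transport _ _ _, hmin⟩

/-- Only nonvanishing needs the seed: `E` is a factor group of some `G ∈ K`, so `S'(G) ≠ 0`. -/
theorem corner_isSimple {h : K ⊆ K'} (p : Seed 𝕂 K)
    {S' : LamModule ℓ K'} (hS' : S'.IsSimple) (hp : (p.mono h).Corresponds S') :
    (corner h S').IsSimple := by
  obtain ⟨q, hE, ⟨θ, -⟩, hmin⟩ := hp
  obtain ⟨G, hG, hfac⟩ := p.isFactor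
  have h1 : S'.eval (up h ⟨G, hG⟩) ≠ ⊥ :=
    eval_ne_bot_of_isFactorGroup hmin.1 (hfac.congr_left θ.symm)
  obtain ⟨z, -, hz⟩ := exists_ne_zero (((isCornerEmb_corner h S').eval_ne_bot_iff _).2 h1)
  exact (isCornerEmb_corner h S').isSimple hS' ⟨z, 0, hz⟩

theorem isSeedModuleVia_iff (h : K ⊆ K') (hK' : ClosedUnderFactorGroups K') (p : Seed 𝕂 K)
    (S : LamModule ℓ K) : p.IsSeedModuleVia h S ↔ p.IsSeedModule S := by
  refine ⟨IsSeedModule.of_via hK', fun hS => ?_⟩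
  obtain ⟨S', hS'⟩ := exists_corresponds ℓ h hK' p
  have h1 : p.IsSeedModuleVia h (corner h S'.1) :=
    ⟨S', hS', LUModule.Iso.equivalence.refl _⟩
  exact ⟨S', hS', hS.iso (IsSeedModule.of_via hK' h1)⟩

theorem exists_isSeedModule_of_seed (ℓ : ℕ+ →* 𝕂ˣ) (p : Seed 𝕂 K) :
    ∃ S : SimpleLamModule ℓ K, p.IsSeedModule S.1 := by
  obtain ⟨S', hS'⟩ := exists_corresponds ℓ (Set.subset_univ K) closedUnderFactorGroups_univ p
  exact ⟨⟨corner _ S'.1, corner_isSimple p S'.2 hS'⟩,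
    IsSeedModule.of_via closedUnderFactorGroups_univ
      ⟨S', hS', LUModule.Iso.equivalence.refl _⟩⟩

theorem exists_isSeedModule (S : LamModule ℓ K) (hS : S.IsSimple) :
    ∃ p : Seed 𝕂 K, p.IsSeedModule S := by
  obtain ⟨T, hT, j, hj⟩ := exists_extension (Set.subset_univ K) S hS
  -- A group of least order with nonzero evaluation is minimal for `≤`, so the module is pure at it.
  have hex : ∃ n, ∃ F : (Set.univ : Set FiniteGrp.{u}), T.eval F ≠ ⊥ ∧ Nat.card F.1 = n := by
    have := hT.1
    obtain ⟨z, hz⟩ := exists_ne (0 : T.carrier)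
    obtain ⟨F, hF⟩ := T.exists_idm_act_ne_zero hz
    exact ⟨_, F, eval_ne_bot (T.act_idm_mem_eval F z) hF, rfl⟩
  obtain ⟨E, hE, hcard⟩ := Nat.find_spec hex
  have hmin : ∀ F, T.eval F ≠ ⊥ → Nat.card E.1 ≤ Nat.card F.1 := by
    intro F hF
    rw [hcard]
    exact Nat.find_min' hex ⟨F, hF, rfl⟩
  have hpure : T.Pure E := by
    refine pure_of_minimal closedUnderFactorGroups_univ T E fun F hF hFE => ?_
    obtain ⟨e⟩ := hFE.mulEquiv_of_card_le (hmin F hF)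
    exact IsFactorGroup.of_mulEquiv e.symm
  have := hpure.isSimpleModule hT hE
  have : Small.{k} (T.eval E) := small_of_isSimpleModule (𝕂 := 𝕂) (G := MulAut E.1) (T.eval E)
  let e := Shrink.linearEquiv (MonoidAlgebra 𝕂 (MulAut E.1)) (T.eval E)
  have hsimple : IsSimpleModule (MonoidAlgebra 𝕂 (MulAut E.1)) (Shrink.{k} (T.eval E)) :=
    IsSimpleModule.congr e
  have hfac : ∃ G ∈ K, IsFactorGroup E.1 G := by
    have := hS.1
    obtain ⟨z, hz⟩ := exists_ne (0 : S.carrier)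
    obtain ⟨G, hG⟩ := S.exists_idm_act_ne_zero hz
    have hG' := (hj.eval_ne_bot_iff G).1 (eval_ne_bot (S.act_idm_mem_eval G z) hG)
    exact ⟨G.1, G.2, hpure.isFactorGroup hT hE hG'⟩
  let p : Seed 𝕂 K := { E := E.1, isFactor := hfac, W := Shrink.{k} (T.eval E) }
  refine ⟨p, T, hT, minimalIn_of_pure hT hpure e.toAddEquiv fun x w => ?_, j, hj⟩
  exact congrArg Subtype.val (e.map_smul x w)

theorem IsSeedModule.condA {p : Seed 𝕂 K} {S : LamModule ℓ K} (h : p.IsSeedModule S) :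
    p.CondA S := by
  obtain ⟨T, hT, hmin, j, hj⟩ := h
  intro G
  rw [hj.eval_ne_bot_iff]
  exact ⟨(hmin.pure closedUnderFactorGroups_univ).isFactorGroup hT hmin.1,
    fun hf => eval_ne_bot_of_isFactorGroup hmin.1 hf⟩

theorem IsSeedModule.condB {p : Seed 𝕂 K} {S : LamModule ℓ K} (h : p.IsSeedModule S) :
    p.CondB S := by
  obtain ⟨T, hT, hmin, j, hj⟩ := h
  intro G B Y _ φ x _
  have h1 := hmin.exists_act_muPhi_ne_zero_iff (up (Set.subset_univ K) G) B Y φ x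
  have h2 := hj.exists_act_ne_zero_iff G (muPhi ℓ G B Y φ x)
  rw [incl_muPhi ℓ G B Y φ (Set.subset_univ K) x] at h2
  exact h2.trans h1

/-- Condition (b) at the idempotent `1` makes `μ_φ(1)` act nontrivially. It factors through the
group of `q`, so `T` is nonzero there, and `p.E` is least. -/
theorem IsSeedModule.isFactorGroup {p q : Seed 𝕂 K} {S : LamModule ℓ K} (h : p.IsSeedModule S)
    (hB : q.CondB S) : IsFactorGroup p.E q.E := by
  obtain ⟨T, hT, hmin, j, hj⟩ := h
  obtain ⟨G, hG, B, Y, _, ⟨φ⟩⟩ := q.isFactor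
  have := q.nontrivial
  obtain ⟨w, hw⟩ := exists_ne (0 : q.W)
  obtain ⟨m, -, hm⟩ := (hj.exists_act_ne_zero_iff ⟨G, hG⟩ _).1
    ((hB ⟨G, hG⟩ B Y φ 1 IsIdempotentElem.one).2 ⟨w, by rwa [one_smul]⟩)
  rw [incl_muPhi] at hm
  exact (hmin.pure closedUnderFactorGroups_univ).isFactorGroup hT hmin.1
    (eval_ne_bot_of_act_muPhi (E := ⟨q.E, Set.mem_univ _⟩) hm)

theorem IsSeedModule.condC {p : Seed 𝕂 K} {S : LamModule ℓ K} (h : p.IsSeedModule S) :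
    p.CondC S := fun _ _ hB => h.isFactorGroup hB

/-- Condition (c) for `q`, tested on `p`, reverses the inequality of `IsSeedModule.isFactorGroup`,
so the groups agree. Condition (b) for both seeds then compares idempotents; characteristic zero
provides semisimplicity. -/
theorem IsSeedModule.equivalent [CharZero 𝕂] {p q : Seed 𝕂 K} {S : LamModule ℓ K}
    (h : p.IsSeedModule S) (hB : q.CondB S) (hC : q.CondC S) : q.Equivalent p := by
  obtain ⟨θ⟩ := (h.isFactorGroup hB).mulEquiv_of_card_le (hC p h.condA h.condB).card_le
  obtain ⟨G, hG, B, Y, _, ⟨φ⟩⟩ := p.isFactor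
  obtain ⟨f, hf⟩ := exists_equiv_of_idempotents (autIso 𝕂 θ).toRingEquiv p.W q.W
    fun e he hm => by
      have h1 := (h.condB ⟨G, hG⟩ B Y φ e he).2 hm
      rw [← muPhi_trans ℓ ⟨G, hG⟩ B Y φ θ] at h1
      exact (hB ⟨G, hG⟩ B Y (φ.trans θ) (autIso 𝕂 θ e) (he.map _)).1 h1
  exact ⟨θ, f, hf⟩

theorem isSeedModule_iff [CharZero 𝕂] (p : Seed 𝕂 K) (S : SimpleLamModule ℓ K) :
    p.IsSeedModule S.1 ↔ p.CondA S.1 ∧ p.CondB S.1 ∧ p.CondC S.1 := by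
  refine ⟨fun h => ⟨h.condA, h.condB, h.condC⟩, fun ⟨_, hB, hC⟩ => ?_⟩
  -- `S` has some seed `q`; the conditions force `p` to be equivalent to it.
  obtain ⟨q, hq⟩ := exists_isSeedModule S.1 S.2
  exact hq.of_equivalent (hq.equivalent hB hC)

/-- The bijection between the isomorphism classes of simple modules and the equivalence classes of
seeds. -/
theorem exists_seed_correspondence [CharZero 𝕂] (ℓ : ℕ+ →* 𝕂ˣ) (K : Set FiniteGrp.{u}) :
    ∃ Φ : Quotient (SimpleModule.setoid.{max k (u + 1)} (Lam ℓ K)) ≃ Quotient (Seed.setoid 𝕂 K),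
      ∀ (S : SimpleLamModule ℓ K) (p : Seed 𝕂 K), Φ ⟦S⟧ = ⟦p⟧ ↔ p.IsSeedModule S.1 := by
  choose σ hσ using fun S : SimpleLamModule ℓ K => exists_isSeedModule S.1 S.2
  have key : ∀ (S : SimpleLamModule ℓ K) (p : Seed 𝕂 K),
      (⟦σ S⟧ : Quotient (Seed.setoid 𝕂 K)) = ⟦p⟧ ↔ p.IsSeedModule S.1 := by
    intro S p
    rw [Quotient.eq]
    exact ⟨fun h => (hσ S).of_equivalent (Equivalent.equivalence.symm h),
      fun h => h.equivalent (hσ S).condB (hσ S).condC⟩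
  let F : Quotient (SimpleModule.setoid.{max k (u + 1)} (Lam ℓ K)) → Quotient (Seed.setoid 𝕂 K) :=
    Quotient.lift (fun S => ⟦σ S⟧) fun S T h => (key S _).2 ((hσ T).of_iso h)
  refine ⟨Equiv.ofBijective F ⟨?_, ?_⟩, key⟩
  · rintro ⟨S⟩ ⟨T⟩ h
    exact Quotient.sound (((key S (σ T)).1 h).iso (hσ T))
  · rintro ⟨p⟩
    obtain ⟨S, hS⟩ := exists_isSeedModule_of_seed ℓ p
    exact ⟨⟦S⟧, (key S p).2 hS⟩

end Seed

end SubgroupCat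

end

open SubgroupCat in
theorem theorem3p5 {𝕂 : Type k} [Field 𝕂] [CharZero 𝕂] (ℓ : ℕ+ →* 𝕂ˣ) (K : Set FiniteGrp.{u}) :
    ∃ Φ : Quotient (SimpleModule.setoid.{max k (u + 1)} (Lam ℓ K)) ≃ Quotient (Seed.setoid 𝕂 K),
      (∀ (K' : Set FiniteGrp.{u}) (h : K ⊆ K'), ClosedUnderFactorGroups K' →
        (∀ p : Seed 𝕂 K, ∃ S' : SimpleLamModule ℓ K', (p.mono h).Corresponds S'.1) ∧
        (∀ (p : Seed 𝕂 K) (S' : SimpleLamModule ℓ K'), (p.mono h).Corresponds S'.1 →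
          (LamModule.corner h S'.1).IsSimple) ∧
        (∀ (S : SimpleLamModule ℓ K) (p : Seed 𝕂 K),
          Φ ⟦S⟧ = ⟦p⟧ ↔ p.IsSeedModuleVia h S.1)) ∧
      (∀ (S : SimpleLamModule ℓ K) (p : Seed 𝕂 K),
        Φ ⟦S⟧ = ⟦p⟧ ↔ p.CondA S.1 ∧ p.CondB S.1 ∧ p.CondC S.1) := by
  obtain ⟨Φ, hΦ⟩ := Seed.exists_seed_correspondence ℓ K
  refine ⟨Φ, fun K' h hK' => ⟨Seed.exists_corresponds ℓ h hK',
    fun p S' => Seed.corner_isSimple p S'.2, fun S p => ?_⟩, fun S p => ?_⟩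
  · rw [hΦ, Seed.isSeedModuleVia_iff h hK']
  · rw [hΦ, Seed.isSeedModule_iff]
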